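/- **Model.** Deterministic protocols run in synchronous rounds over authenticated channels. Each *virtual party* is simulated by a real party, and one real party may simulate several virtual parties. An adaptive adversary corrupts real parties over time; a corrupted party stays corrupted and sends arbitrary messages. A virtual party is *honest* in an execution if its real party is not corrupted by the end of the protocol, and *byzantine* otherwise. Parties use a hash function $H_\kappa:\{0,1\}^\star\to\{0,1\}^\kappa$ and possibly signatures under a public key infrastructure for the real parties. As usual in this setting, protocol guarantees are claimed for executions in which the adversary neither finds a collision of $H_\kappa$ nor forges a signature: no two distinct strings hashed by (at that time) honest parties have the same hash, and no honest party accepts a signature of a still honest party on a message which that party has not signed before. Communication is the total number of bits sent over the network by honest parties; "an $L$-bit message" means one of at most $L$ bits, for a publicly known $L$. A protocol among $n$ parties *achieves Byzantine Agreement (BA)* with up to $t$ corruptions if, whenever at most $t$ parties are byzantine: all honest parties terminate; if all honest parties hold the same input $v$, they output $v$; and all honest parties output the same value. **Lemma.** Let $\Pi_{\mathrm{BA}}$ be a BA protocol (given for all $\kappa, L, n\ge 1$) with resilience $t(n)$, round complexity $R(n)=O(n)$ and communication complexity $O((L+\kappa)n^2)$ for $L$-bit inputs. Assume that it satisfies *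 *Multi-Participation Safety*: since it achieves BA among $n$ parties with up to $t(n)$ corruptions, it also achieves BA among $n$ virtual parties of which up to $t(n)$ are simulated by byzantine parties; and * *Extra-Corruptions Safety*: its round and communication bounds hold among $n$ virtual parties also when any number of them, in particular more than $t(n)$, are byzantine. Then there are a protocol $\mathrm{Supersend}^L$ (for all $\kappa\ge 1$, $L \ge 0$, and group sizes $n_A,n_B\ge 1$) and an absolute constant (depending only on $\Pi_{\mathrm{BA}}$) hidden in the $O(\cdot)$ below, such that the following holds for any two groups $A$, $B$ of virtual parties of sizes $n_A$, $n_B$ in which every member of $A$ that is honest at the start holds some $L$-bit message as input. 1. Regardless of the number of byzantine parties, all honest parties complete $\mathrm{Supersend}^L$ within a number of rounds that depends only on $n_A, n_B$ and is $O(n_B)$; every honest virtual party in $B$ outputs either an $L$-bit message or $\bot$; and the communication is $$O\bigl(L\,(n_A+n_B)+\kappa\, n_B\log(n_B+1)\,(n_A+n_B)\bigr)\text{ bits.}$$ 2. If moreover at most $t(n_B)$ virtual parties in $B$ are byzantine and more than $n_B/2$ virtual parties in $B$ are honest, then all honest virtual parties in $B$ obtain the same output. 3. If, in addition, more than $n_A/2$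 virtual parties in $A$ are honest and hold the same message $m$, then all honest virtual parties in $B$ output $m$. The protocol $\mathrm{Supersend}^L$ uses signatures only if $\Pi_{\mathrm{BA}}$ does. If the honest parties perform at most $q$ cryptographic operations (hash evaluations, signatures, verifications) in every execution of $\Pi_{\mathrm{BA}}$ among $n_B$ virtual parties with $\kappa$-bit inputs, then in every execution of $\mathrm{Supersend}^L$ they perform $O((n_A+n_B)^3+q)$. -/

import Mathlib

/-- Bitstrings. As a network message, the empty bitstring stands for "nothing is sent". -/
abbrev Bits : Type := List Bool

/-- A deterministic local computation with oracle access to the hash function, to the signing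
function of the party that runs it, and to the verification of signatures of party `i`. -/
inductive Prog (ι α : Type) : Type
  | ret (a : α) : Prog ι α
  | hash (x : Bits) (k : Bits → Prog ι α) : Prog ι α
  | sign (x : Bits) (k : Bits → Prog ι α) : Prog ι α
  | verify (i : ι) (x sig : Bits) (k : Bool → Prog ι α) : Prog ι α

/-- The record of one cryptographic operation; for a verification also its result. -/
inductive Query (ι : Type) : Type
  | hash (x : Bits) : Query ι
  | sign (x : Bits) : Query ι
  | verify (i : ι) (x sig : Bits) (accepted : Bool) : Query ι

/-- The cryptographic environment: a hash function with `κ`-bit values, and a public key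
infrastructure for the real parties `P`. Virtual party `i` signs `x` by having the real party that
simulates it sign the pair `(x, i)`. -/
structure Crypto (ι P : Type) (κ : ℕ) where
  hash : Bits → Bits
  hash_length : ∀ x, (hash x).length = κ
  sign : P → ι → Bits → Bits
  verify : P → ι → Bits → Bits → Bool
  verify_sign : ∀ p i x, verify p i x (sign p i x) = true

/-- Result of a local computation of virtual party `me`, with the operations it performed. -/
def Prog.eval {ι P α : Type} {κ : ℕ} (E : Crypto ι P κ) (owner : ι → P) (me : ι) :
    Prog ι α → α × List (Query ι)
  | .ret a => (a, [])
  | .hash x k =>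
      let r := Prog.eval E owner me (k (E.hash x))
      (r.1, .hash x :: r.2)
  | .sign x k =>
      let r := Prog.eval E owner me (k (E.sign (owner me) me x))
      (r.1, .sign x :: r.2)
  | .verify i x sig k =>
      let b := E.verify (owner i) i x sig
      let r := Prog.eval E owner me (k b)
      (r.1, .verify i x sig b :: r.2)

/-- The computation never uses signatures. -/
def Prog.SigFree {ι α : Type} : Prog ι α → Prop
  | .ret _ => True
  | .hash _ k => ∀ b, (k b).SigFree
  | .sign _ _ => False
  | .verify _ _ _ _ => False

/-- A deterministic synchronous protocol for (virtual) parties indexed by `ι`. In every round a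
party sends `send me s j` to each `j`, and then updates its state from the messages received.
It terminates as soon as `output` is defined. -/
structure Protocol (ι Out : Type) where
  State : Type
  init : ι → Bits → Prog ι State
  send : ι → State → ι → Bits
  recv : ι → State → (ι → Bits) → Prog ι State
  output : State → Option Out

/-- An unauthenticated protocol: no party ever uses signatures. -/
def Protocol.SigFree {ι Out : Type} (Q : Protocol ι Out) : Prop :=
  (∀ i x, (Q.init i x).SigFree) ∧ ∀ i s inbox, (Q.recv i s inbox).SigFree

/-- Everything that is not fixed by the protocol: which real party simulates which virtual party,
the inputs, the cryptographic environment, the real parties corrupted by each point in time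
(adaptively, and for good), and the messages `adv r j i` that corrupted virtual parties `j` send
to `i` in round `r`. -/
structure Execution (ι P : Type) (κ : ℕ) where
  owner : ι → P
  input : ι → Bits
  crypto : Crypto ι P κ
  corrupt : ℕ → Set P
  corrupt_mono : Monotone corrupt
  adv : ℕ → ι → ι → Bits

namespace Execution

variable {ι P : Type} {κ : ℕ}

/-- Virtual party `i` is honest up to and including time `r`. -/
def Honest (e : Execution ι P κ) (r : ℕ) (i : ι) : Prop := e.owner i ∉ e.corrupt r

/-- The (initially) honest parties hold inputs of at most `L` bits. -/
def InputsAtMost (e : Execution ι P κ) (L : ℕ) : Prop :=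
  ∀ i, e.Honest 0 i → (e.input i).length ≤ L

end Execution

namespace Protocol

variable {ι Out P : Type} {κ : ℕ}

/-- A party that has terminated sends nothing. -/
def outgoing (Q : Protocol ι Out) (j : ι) (s : Q.State) (i : ι) : Bits :=
  if (Q.output s).isSome then [] else Q.send j s i

open Classical in
/-- State of each virtual party after `r` rounds, with the operations performed in the local
computation that leads to this state. (Meaningful only for parties honest at time `r`.) -/
noncomputable def run (Q : Protocol ι Out) (e : Execution ι P κ) :
    ℕ → ι → Q.State × List (Query ι)
  | 0 => fun i => (Q.init i (e.input i)).eval e.crypto e.owner i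
  | r + 1 => fun i =>
      let s := (run Q e r i).1
      if (Q.output s).isSome then (s, [])
      else
        (Q.recv i s fun j =>
          if e.Honest r j then Q.outgoing j (run Q e r j).1 i else e.adv r j i).eval
          e.crypto e.owner i

/-- Output of virtual party `i` after `r` rounds, if it has terminated by then. -/
noncomputable def outputAt (Q : Protocol ι Out) (e : Execution ι P κ) (r : ℕ) (i : ι) :
    Option Out :=
  Q.output (Q.run e r i).1

/-- The cryptographic operations of virtual party `i` at time `r`. -/
noncomputable def queriesAt (Q : Protocol ι Out) (e : Execution ι P κ) (r : ℕ) (i : ι) :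
    List (Query ι) :=
  (Q.run e r i).2

open Classical in
/-- Total number of bits sent over the network by honest parties in the first `R` rounds
(messages between two virtual parties of the same real party are local). -/
noncomputable def bitsSent [Fintype ι] (Q : Protocol ι Out) (e : Execution ι P κ) (R : ℕ) : ℕ :=
  ∑ r ∈ Finset.range R, ∑ i, ∑ j,
    if e.Honest r i ∧ e.owner i ≠ e.owner j then (Q.outgoing i (Q.run e r i).1 j).length else 0

open Classical in
/-- Total number of cryptographic operations performed by honest parties within `R` rounds. -/
noncomputable def numQueries [Fintype ι] (Q : Protocol ι Out) (e : Execution ι P κ) (R : ℕ) : ℕ :=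
  ∑ r ∈ Finset.range (R + 1), ∑ i, if e.Honest r i then (Q.queriesAt e r i).length else 0

/-- No collision occurs among the strings hashed by honest parties within `R` rounds. -/
def CollisionFree (Q : Protocol ι Out) (e : Execution ι P κ) (R : ℕ) : Prop :=
  ∀ r ≤ R, ∀ r' ≤ R, ∀ i i' x x', e.Honest r i → e.Honest r' i' →
    Query.hash x ∈ Q.queriesAt e r i → Query.hash x' ∈ Q.queriesAt e r' i' →
    e.crypto.hash x = e.crypto.hash x' → x = x'

/-- No honest party accepts, within `R` rounds, a signature of a still honest party on a message
which that party has not signed before. -/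
def ForgeryFree (Q : Protocol ι Out) (e : Execution ι P κ) (R : ℕ) : Prop :=
  ∀ r ≤ R, ∀ i j x sig, e.Honest r i → e.Honest r j →
    Query.verify j x sig true ∈ Q.queriesAt e r i →
    ∃ r', (r' < r ∨ r' = r ∧ j = i) ∧ Query.sign x ∈ Q.queriesAt e r' j

/-- Within `R` rounds the adversary neither finds a hash collision nor forges a signature. -/
def Clean (Q : Protocol ι Out) (e : Execution ι P κ) (R : ℕ) : Prop :=
  Q.CollisionFree e R ∧ Q.ForgeryFree e R

/-- All honest parties terminate within `R` rounds. -/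
def Terminates (Q : Protocol ι Out) (e : Execution ι P κ) (R : ℕ) : Prop :=
  ∀ i, e.Honest R i → (Q.outputAt e R i).isSome

/-- If all honest parties hold the same input `v`, they output `v`. -/
def Valid (Q : Protocol ι Bits) (e : Execution ι P κ) (R : ℕ) : Prop :=
  ∀ v, (∀ i, e.Honest R i → e.input i = v) → ∀ i, e.Honest R i → Q.outputAt e R i = some v

/-- All honest parties output the same value. -/
def Agrees (Q : Protocol ι Out) (e : Execution ι P κ) (R : ℕ) : Prop :=
  ∀ i j, e.Honest R i → e.Honest R j → Q.outputAt e R i = Q.outputAt e R j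

end Protocol

open Classical in
/-- Number of virtual parties, among those simulated as described by `owner`, whose real party
lies in `C`. -/
noncomputable def numIn {ι P : Type} [Fintype ι] (owner : ι → P) (C : Set P) : ℕ :=
  (Finset.univ.filter fun i => owner i ∈ C).card

section BA

variable {n : ℕ} (Q : Protocol (Fin n) Bits) (κ L t R B : ℕ)

/-- `Q` achieves Byzantine Agreement on inputs of at most `L` bits, within `R` rounds, among `n`
virtual parties simulated by real parties as described by `owner`, whenever at most `t` of the
virtual parties are corrupted. -/
def AchievesBAIn {P : Type} (owner : Fin n → P) : Prop :=
  ∀ e : Execution (Fin n) P κ, e.owner = owner → e.InputsAtMost L →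
    numIn owner (e.corrupt R) ≤ t → Q.Clean e R →
    Q.Terminates e R ∧ Q.Valid e R ∧ Q.Agrees e R

/-- Byzantine Agreement among `n` real parties. -/
def AchievesBA : Prop := AchievesBAIn Q κ L t R (id : Fin n → Fin n)

/-- If `Q` achieves BA among `n` parties, at most `t` of them corrupted, then also among `n`
virtual parties, at most `t` of them simulated by corrupted parties. -/
def MultiParticipationSafe : Prop :=
  AchievesBA Q κ L t R → ∀ (P : Type) (owner : Fin n → P), AchievesBAIn Q κ L t R owner

/-- Among `n` real parties, at most `t` of them corrupted, the honest ones complete `Q` within `R`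
rounds and send at most `B` bits in total. -/
def HasComplexity : Prop :=
  ∀ e : Execution (Fin n) (Fin n) κ, e.owner = id → e.InputsAtMost L →
    numIn e.owner (e.corrupt R) ≤ t → Q.Clean e R → Q.Terminates e R ∧ Q.bitsSent e R ≤ B

/-- The round and communication bounds that hold among `n` real parties with at most `t`
corruptions hold among `n` virtual parties with any number of corruptions. -/
def ExtraCorruptionsSafe : Prop :=
  HasComplexity Q κ L t R B →
    ∀ (P : Type) (e : Execution (Fin n) P κ), e.InputsAtMost L → Q.Clean e R →
      Q.Terminates e R ∧ Q.bitsSent e R ≤ B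

end BA

/-!
Supersending combines a Reed-Solomon code with a Merkle tree. A message of at most `L` bits is split
into `n` shares, one for each receiver, any `n / 2 + 1` of which determine it (`eq_of_shares_eq`).
A share together with its siblings in the Merkle tree over all shares takes
`O(L / n + κ log (n + 1))` bits, so that `O(n (nA + n))` of them are affordable. A receiver can
check such a certified share against the root, and as long as honest parties do not hash colliding
strings, all shares that they accept below the root of a message are the shares of this message
(`merkle_binding`, `share_eq_of_checkShare`). Hence every honest receiver that gets more than
`n / 2` valid shares decodes the message, whatever else it receives (`collectShares_of_valid`).

The senders deal their shares. The receivers exchange those that match the root sent by a majority,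
and decode; if an honest majority of the senders holds `m`, all honest receivers obtain `m`
(`decoded_of_majority`). In general the decoded messages differ, or do not exist. A first instance
of Byzantine Agreement on the roots provides a common root, but not necessarily one that belongs to
the message of an honest receiver. A second instance, in which the input tells whether the receiver
knows a message with the common root, settles this: if its outcome is affirmative, then by validity
some receiver that is still honest knows such a message. It deals the shares, all honest receivers
obtain their own one, exchange them and decode (`collect_of_go`). Otherwise all output `none`.
Delivery follows from the validity of both instances (`delivery_supersend`).

Both instances run on `κ`-bit inputs, which costs `O(κ n²)` bits regardless of the number of
corruptions. The run of either instance inside the supersending protocol is its run in an execution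
obtained by shifting time (`run_root`, `run_known`). For this execution to be free of forgeries, the
strings signed in the two instances carry different prefixes, so that no signature of one of them is
accepted in the other (`Protocol.clean_sub`, `sign_mem_queriesAt`).
-/

/-! ### Local computations -/

namespace Prog

variable {ι α β : Type}

/-- Sequential composition of local computations. -/
def bind : Prog ι α → (α → Prog ι β) → Prog ι β
  | .ret a, f => f a
  | .hash x k, f => .hash x fun b => (k b).bind f
  | .sign x k, f => .sign x fun b => (k b).bind f
  | .verify i x sig k, f => .verify i x sig fun b => (k b).bind f

/-- Run `f 0`, …, `f (n - 1)` one after the other and collect the results. -/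
def forFin : {n : ℕ} → (Fin n → Prog ι β) → Prog ι (Fin n → β)
  | 0, _ => .ret Fin.elim0
  | _ + 1, f => (f 0).bind fun b => (forFin fun i => f i.succ).bind fun bs => .ret (Fin.cons b bs)

section eval

variable {P : Type} {κ : ℕ} (E : Crypto ι P κ) (owner : ι → P) (me : ι)

theorem eval_bind (p : Prog ι α) (f : α → Prog ι β) :
    (p.bind f).eval E owner me =
      (((f (p.eval E owner me).1).eval E owner me).1,
        (p.eval E owner me).2 ++ ((f (p.eval E owner me).1).eval E owner me).2) := by
  induction p with
  | ret a => simp [bind, eval]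
  | hash x k ih => simp [bind, eval, ih]
  | sign x k ih => simp [bind, eval, ih]
  | verify i x sig k ih => simp [bind, eval, ih]

theorem eval_forFin_fst {n : ℕ} (f : Fin n → Prog ι β) :
    ((forFin f).eval E owner me).1 = fun i => ((f i).eval E owner me).1 := by
  induction n with
  | zero => funext i; exact i.elim0
  | succ n ih =>
    funext i
    simp only [forFin, eval_bind, eval, ih]
    refine Fin.cases ?_ (fun i => ?_) i <;> simp

theorem mem_eval_forFin {n : ℕ} {f : Fin n → Prog ι β} {x : Query ι} (i : Fin n)
    (h : x ∈ ((f i).eval E owner me).2) : x ∈ ((forFin f).eval E owner me).2 := by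
  induction n with
  | zero => exact i.elim0
  | succ n ih =>
    simp only [forFin, eval_bind, eval, List.mem_append]
    refine Fin.cases (fun h => ?_) (fun i h => ?_) i h
    · exact Or.inl h
    · exact Or.inr (Or.inl (ih i h))

theorem length_eval_forFin_le {n c : ℕ} {f : Fin n → Prog ι β}
    (h : ∀ i, ((f i).eval E owner me).2.length ≤ c) :
    ((forFin f).eval E owner me).2.length ≤ n * c := by
  induction n with
  | zero => simp [forFin, eval]
  | succ n ih =>
    have h1 := h 0
    have h2 := ih (f := fun i => f i.succ) fun i => h i.succ
    simp only [forFin, eval_bind, eval, List.length_append, List.length_nil]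
    rw [Nat.succ_mul]
    omega

theorem SigFree.not_sign {p : Prog ι α} (hp : p.SigFree) (x : Bits) :
    Query.sign x ∉ (p.eval E owner me).2 := by
  induction p with
  | ret a => simp [eval]
  | hash y k ih => simpa [eval] using ih _ (hp _)
  | sign y k => exact hp.elim
  | verify i y sig k => exact hp.elim

/-- Without signatures, a computation does not depend on the party that runs it. -/
theorem SigFree.eval_eq {p : Prog ι α} (hp : p.SigFree) (me' : ι) :
    p.eval E owner me = p.eval E owner me' := by
  induction p with
  | ret a => rfl
  | hash x k ih => simp only [eval, ih _ (hp _)]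
  | sign x k => exact hp.elim
  | verify i x sig k => exact hp.elim

end eval

theorem SigFree.bind {p : Prog ι α} {f : α → Prog ι β} (hp : p.SigFree)
    (hf : ∀ a, (f a).SigFree) : (p.bind f).SigFree := by
  induction p with
  | ret a => exact hf a
  | hash x k ih => exact fun b => ih b (hp b)
  | sign x k => exact hp.elim
  | verify i x sig k => exact hp.elim

theorem SigFree.forFin {n : ℕ} {f : Fin n → Prog ι β} (hf : ∀ i, (f i).SigFree) :
    (Prog.forFin f).SigFree := by
  induction n with
  | zero => exact trivial
  | succ n ih => exact (hf 0).bind fun b => (ih fun i => hf i.succ).bind fun _ => trivial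

end Prog

/-! ### Merkle trees -/

section Merkle

variable {ι P : Type} {κ : ℕ}

/-- Hash the leaves `v p`, for `p` a path of length `d`, into a Merkle tree. The result is the root
together with the function that maps a path to the concatenation of the siblings along it, from
the root down. -/
def merkleTree : (d : ℕ) → (v : Bits → Bits) → Prog ι (Bits × (Bits → Bits))
  | 0, v => .hash (v []) fun h => .ret (h, fun _ => [])
  | d + 1, v =>
      (merkleTree d fun p => v (false :: p)).bind fun l =>
        (merkleTree d fun p => v (true :: p)).bind fun r =>
          .hash (l.1 ++ r.1) fun h =>
            .ret (h, fun p => if p.head? = some true then l.1 ++ r.2 p.tail else r.1 ++ l.2 p.tail)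

/-- The root of a Merkle tree computed from the leaf `x` at path `p` and the siblings along the
path, each of them `κ` bits long. -/
def merklePath (κ : ℕ) : (p : Bits) → (x sib : Bits) → Prog ι Bits
  | [], x, _ => .hash x .ret
  | c :: p, x, sib =>
      (merklePath κ p x (sib.drop κ)).bind fun h =>
        .hash (if c then sib.take κ ++ h else h ++ sib.take κ) .ret

theorem merkleTree_sigFree (d : ℕ) (v : Bits → Bits) : (merkleTree d v : Prog ι _).SigFree := by
  induction d generalizing v with
  | zero => exact fun _ => trivial
  | succ d ih => exact (ih _).bind fun _ => (ih _).bind fun _ _ => trivial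

theorem merklePath_sigFree (p x sib : Bits) : (merklePath κ p x sib : Prog ι _).SigFree := by
  induction p generalizing sib with
  | nil => exact fun _ => trivial
  | cons c p ih => exact (ih _).bind fun _ _ => trivial

variable (E : Crypto ι P κ) (owner : ι → P) (me : ι)

theorem length_merkleTree_root (d : ℕ) (v : Bits → Bits) :
    ((merkleTree d v).eval E owner me).1.1.length = κ := by
  cases d <;> simp [merkleTree, Prog.eval_bind, Prog.eval, E.hash_length]

theorem length_merklePath (p x sib : Bits) :
    ((merklePath κ p x sib).eval E owner me).1.length = κ := by
  cases p <;> simp [merklePath, Prog.eval_bind, Prog.eval, E.hash_length]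

theorem length_merkleTree_siblings (d : ℕ) (v : Bits → Bits) (p : Bits) :
    (((merkleTree d v).eval E owner me).1.2 p).length = d * κ := by
  induction d generalizing v p with
  | zero => simp [merkleTree, Prog.eval]
  | succ d ih =>
    simp only [merkleTree, Prog.eval_bind, Prog.eval]
    split_ifs <;> simp only [List.length_append, ih, length_merkleTree_root] <;> ring

theorem merklePath_of_merkleTree (me' : ι) (d : ℕ) (v : Bits → Bits) (p : Bits)
    (hp : p.length = d) :
    ((merklePath κ p (v p) (((merkleTree d v).eval E owner me').1.2 p)).eval E owner me).1 =
      ((merkleTree d v).eval E owner me').1.1 := by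
  induction d generalizing v p with
  | zero =>
    obtain rfl := List.length_eq_zero_iff.1 hp
    rfl
  | succ d ih =>
    obtain _ | ⟨c, p⟩ := p
    · simp at hp
    replace hp : p.length = d := by simpa using hp
    have ht := fun v => length_merkleTree_root E owner me' d v
    have hf := ih (fun p => v (false :: p)) p hp
    have ht' := ih (fun p => v (true :: p)) p hp
    cases c <;>
    · simp only [merkleTree, merklePath, Prog.eval_bind, Prog.eval]
      simp [ht, List.take_left', List.drop_left', hf, ht']

/-- Binding: if no collision occurs between the strings hashed for a tree and those hashed for a
path with the same root, then the path ends in the leaf of the tree. -/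
theorem merkle_binding (me' : ι) (d : ℕ) (v : Bits → Bits) (p x sib : Bits) (hp : p.length = d)
    (hcf : ∀ y y', Query.hash y ∈ ((merkleTree d v).eval E owner me).2 →
      Query.hash y' ∈ ((merklePath κ p x sib).eval E owner me').2 →
      E.hash y = E.hash y' → y = y')
    (h : ((merkleTree d v).eval E owner me).1.1 =
      ((merklePath κ p x sib).eval E owner me').1) : v p = x := by
  induction d generalizing v p sib with
  | zero =>
    obtain rfl := List.length_eq_zero_iff.1 hp
    exact hcf _ _ (by simp [merkleTree, Prog.eval]) (by simp [merklePath, Prog.eval])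
      (by simpa [merkleTree, merklePath, Prog.eval] using h)
  | succ d ih =>
    obtain _ | ⟨c, p⟩ := p
    · simp at hp
    replace hp : p.length = d := by simpa using hp
    have hl := length_merkleTree_root E owner me d (fun p => v (false :: p))
    have hr := length_merkleTree_root E owner me d (fun p => v (true :: p))
    have hx := length_merklePath E owner me' p x (sib.drop κ)
    simp only [merkleTree, merklePath, Prog.eval_bind, Prog.eval, List.mem_append,
      List.mem_cons, List.not_mem_nil, or_false] at h hcf
    have heq := hcf _ _ (Or.inr (Or.inr rfl)) (Or.inr rfl) h
    cases c
    · refine ih (fun p => v (false :: p)) p (sib.drop κ) hp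
        (fun y y' hy hy' => hcf y y' (Or.inl hy) (Or.inl hy')) ?_
      exact (List.append_inj heq (by simp [hl, hx])).1
    · refine ih (fun p => v (true :: p)) p (sib.drop κ) hp
        (fun y y' hy hy' => hcf y y' (Or.inr (Or.inl hy)) (Or.inl hy')) ?_
      exact (List.append_inj' heq (by simp [hr, hx])).2

theorem numQueries_merkleTree (d : ℕ) (v : Bits → Bits) :
    ((merkleTree d v).eval E owner me).2.length + 1 = 2 * 2 ^ d := by
  induction d generalizing v with
  | zero => simp [merkleTree, Prog.eval]
  | succ d ih =>
    have h1 := ih (fun p => v (false :: p))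
    have h2 := ih (fun p => v (true :: p))
    simp only [merkleTree, Prog.eval_bind, Prog.eval, List.length_append, List.length_cons,
      List.length_nil, pow_succ]
    omega

theorem numQueries_merklePath (p x sib : Bits) :
    ((merklePath κ p x sib).eval E owner me).2.length = p.length + 1 := by
  induction p generalizing sib with
  | nil => simp [merklePath, Prog.eval]
  | cons c p ih => simp [merklePath, Prog.eval_bind, Prog.eval, ih]

end Merkle

/-! ### Erasure code -/

/-- Depth of the Merkle tree over `n` shares. -/
def treeDepth (n : ℕ) : ℕ := Nat.clog 2 n

/-- Number of bits of one of the `n` shares of an `L`-bit message. Any `n / 2 + 1` shares carry at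
least `L + 1` bits, enough for the strings of at most `L` bits, and the alphabet is large enough
for a Reed-Solomon code of length `n`. -/
def shareLen (L n : ℕ) : ℕ := (L + 1) / (n / 2 + 1) + 1 + treeDepth n

open Polynomial in
theorem exists_code (L n : ℕ) : ∃ enc : Bits → Fin n → Bits,
    (∀ m j, (enc m j).length = shareLen L n) ∧
    ∀ m m' : Bits, m.length ≤ L → m'.length ≤ L → ∀ s : Finset (Fin n), n / 2 + 1 ≤ s.card →
      (∀ j ∈ s, enc m j = enc m' j) → m = m' := by
  classical
  set k := n / 2 + 1 with hk
  set S := shareLen L n with hS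
  have hS0 : S ≠ 0 := by simp [hS, shareLen]
  let F := GaloisField 2 S
  have : Finite F := inferInstance
  have : Fintype F := Fintype.ofFinite F
  have hF : Fintype.card F = 2 ^ S := by
    rw [← Nat.card_eq_fintype_card]; exact GaloisField.card 2 S hS0
  have hn : n ≤ 2 ^ S :=
    (Nat.le_pow_clog one_lt_two n).trans (Nat.pow_le_pow_right two_pos (by
      simp [hS, shareLen, treeDepth]))
  obtain ⟨pt⟩ : Nonempty (Fin n ↪ F) := Function.Embedding.nonempty_of_card_le (by simpa [hF])
  obtain ⟨φ⟩ : Nonempty (F ≃ List.Vector Bool S) := ⟨Fintype.equivOfCardEq (by simp [hF])⟩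
  -- strings of at most `L` bits, sorted by their length
  have hSk : L + 1 ≤ S * k := by
    have h1 := Nat.lt_mul_div_succ (L + 1) (show 0 < k by omega)
    have h2 : (L + 1) / k + 1 ≤ S := by simp [hS, shareLen, hk]
    calc L + 1 ≤ k * ((L + 1) / k + 1) := h1.le
      _ ≤ k * S := Nat.mul_le_mul_left _ h2
      _ = S * k := Nat.mul_comm _ _
  obtain ⟨ψ⟩ : Nonempty ((Σ i : Fin (L + 1), List.Vector Bool i) ↪ (Fin k → F)) := by
    refine Function.Embedding.nonempty_of_card_le ?_
    have h1 : Fintype.card (Σ i : Fin (L + 1), List.Vector Bool i) ≤ 2 ^ (L + 1) := by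
      simp only [Fintype.card_sigma, card_vector, Fintype.card_bool]
      rw [Fin.sum_univ_eq_sum_range (fun i => 2 ^ i)]
      exact (Nat.geomSum_lt le_rfl (by simp)).le
    refine h1.trans ?_
    rw [Fintype.card_fun, hF, Fintype.card_fin, ← pow_mul]
    exact Nat.pow_le_pow_right two_pos hSk
  let toσ : Bits → Σ i : Fin (L + 1), List.Vector Bool i := fun m =>
    ⟨⟨(m.take L).length, by simp⟩, ⟨m.take L, rfl⟩⟩
  have htoσ : ∀ m m', toσ m = toσ m' → m.take L = m'.take L := by
    intro m m' h
    exact congrArg (fun x : Σ i : Fin (L + 1), List.Vector Bool i => x.2.1) h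
  let poly : Bits → degreeLT F k := fun m => (degreeLTEquiv F k).symm (ψ (toσ m))
  refine ⟨fun m j => (φ ((poly m : F[X]).eval (pt j))).1, fun m j => (φ _).2, ?_⟩
  intro m m' hm hm' s hs h
  have h1 : (poly m : F[X]) = poly m' := by
    refine eq_of_degrees_lt_of_eval_index_eq s (v := pt) pt.injective.injOn ?_ ?_ ?_
    · exact (mem_degreeLT.1 (poly m).2).trans_le (by exact_mod_cast hs)
    · exact (mem_degreeLT.1 (poly m').2).trans_le (by exact_mod_cast hs)
    · intro j hj
      exact φ.injective (Subtype.ext (h j hj))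
  have h2 := htoσ m m' (ψ.injective ((degreeLTEquiv F k).symm.injective (Subtype.ext h1)))
  rwa [List.take_of_length_le hm, List.take_of_length_le hm'] at h2

/-- A Reed-Solomon code: `shares L n m j` is the `j`-th of the `n` shares of the message `m`. -/
noncomputable def shares (L n : ℕ) : Bits → Fin n → Bits := (exists_code L n).choose

theorem length_shares (L n : ℕ) (m : Bits) (j : Fin n) :
    (shares L n m j).length = shareLen L n := (exists_code L n).choose_spec.1 m j

theorem eq_of_shares_eq {L n : ℕ} {m m' : Bits} (hm : m.length ≤ L) (hm' : m'.length ≤ L)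
    {s : Finset (Fin n)} (hs : n / 2 + 1 ≤ s.card)
    (h : ∀ j ∈ s, shares L n m j = shares L n m' j) : m = m' :=
  (exists_code L n).choose_spec.2 m m' hm hm' s hs h

/-- The path of the `j`-th leaf in the Merkle tree: the binary digits of `j`. -/
def leafPath (n : ℕ) (j : Fin n) : Bits := List.ofFn fun i : Fin (treeDepth n) => j.1.testBit i

theorem length_leafPath (n : ℕ) (j : Fin n) : (leafPath n j).length = treeDepth n := by
  simp [leafPath]

theorem leafPath_injective (n : ℕ) : Function.Injective (leafPath n) := by
  intro i j h
  have h1 := List.ofFn_injective h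
  have hlt : ∀ k : Fin n, k.1 < 2 ^ treeDepth n := fun k =>
    k.2.trans_le (Nat.le_pow_clog one_lt_two n)
  refine Fin.ext (Nat.eq_of_testBit_eq fun b => ?_)
  by_cases hb : b < treeDepth n
  · exact congrFun h1 ⟨b, hb⟩
  · have hle : 2 ^ treeDepth n ≤ 2 ^ b := Nat.pow_le_pow_right two_pos (not_lt.1 hb)
    rw [Nat.testBit_lt_two_pow ((hlt i).trans_le hle),
      Nat.testBit_lt_two_pow ((hlt j).trans_le hle)]

open Classical in
/-- The leaves of the Merkle tree over the shares of `m`. Paths that belong to no share carry the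
empty string. -/
noncomputable def leaves (L n : ℕ) (m p : Bits) : Bits :=
  if h : ∃ j, leafPath n j = p then shares L n m h.choose else []

theorem leaves_leafPath (L n : ℕ) (m : Bits) (j : Fin n) :
    leaves L n m (leafPath n j) = shares L n m j := by
  have h : ∃ i, leafPath n i = leafPath n j := ⟨j, rfl⟩
  rw [leaves, dif_pos h, leafPath_injective n h.choose_spec]

/-! ### Subprotocols -/

section Embed

variable {ι ι' P α : Type} {κ : ℕ}

/-- Run a local computation of party `i` as one of party `g i`. Every signed string is prefixed
by the bit `c`, so that signatures of subprotocols with different `c` cannot be confused. -/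
def Prog.embed (g : ι → ι') (c : Bool) : Prog ι α → Prog ι' α
  | .ret a => .ret a
  | .hash x k => .hash x fun b => (k b).embed g c
  | .sign x k => .sign (c :: x) fun b => (k b).embed g c
  | .verify i x sig k => .verify (g i) (c :: x) sig fun b => (k b).embed g c

/-- What the operation recorded by a query becomes under `Prog.embed`. -/
def Query.embed (g : ι → ι') (c : Bool) : Query ι → Query ι'
  | .hash x => .hash x
  | .sign x => .sign (c :: x)
  | .verify i x sig b => .verify (g i) (c :: x) sig b

theorem Prog.SigFree.embed {p : Prog ι α} (g : ι → ι') (c : Bool) (hp : p.SigFree) :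
    (p.embed g c).SigFree := by
  induction p with
  | ret a => exact trivial
  | hash x k ih => exact fun b => ih b (hp b)
  | sign x k => exact hp.elim
  | verify i x sig k => exact hp.elim

/-- The execution that a subprotocol among the parties `g i` sees if it starts at time `T₀` on the
inputs `input`, with its signed strings prefixed by `c`. -/
def Execution.sub (e : Execution ι' P κ) (g : ι → ι') (c : Bool) (T₀ : ℕ) (input : ι → Bits) :
    Execution ι P κ where
  owner i := e.owner (g i)
  input := input
  crypto :=
    { hash := e.crypto.hash
      hash_length := e.crypto.hash_length
      sign := fun p i x => e.crypto.sign p (g i) (c :: x)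
      verify := fun p i x sig => e.crypto.verify p (g i) (c :: x) sig
      verify_sign := fun p i x => e.crypto.verify_sign p (g i) (c :: x) }
  corrupt r := e.corrupt (T₀ + r)
  corrupt_mono _ _ h := e.corrupt_mono (Nat.add_le_add_left h T₀)
  adv r j i := e.adv (T₀ + r) (g j) (g i)

theorem Prog.eval_embed (e : Execution ι' P κ) (g : ι → ι') (c : Bool) (T₀ : ℕ)
    (input : ι → Bits) (p : Prog ι α) (i : ι) :
    (p.embed g c).eval e.crypto e.owner (g i) =
      ((p.eval (e.sub g c T₀ input).crypto (e.sub g c T₀ input).owner i).1,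
        (p.eval (e.sub g c T₀ input).crypto (e.sub g c T₀ input).owner i).2.map
          (Query.embed g c)) := by
  induction p with
  | ret a => rfl
  | hash x k ih => simp only [Prog.embed, Prog.eval, ih]; rfl
  | sign x k ih => simp only [Prog.embed, Prog.eval, ih]; rfl
  | verify j x sig k ih => simp only [Prog.embed, Prog.eval, ih]; rfl

theorem Execution.Honest.anti {e : Execution ι P κ} {r r' : ℕ} {i : ι} (h : e.Honest r' i)
    (hr : r ≤ r') : e.Honest r i := fun hi => h (e.corrupt_mono hr hi)

open Classical in
/-- The messages that party `i` receives in round `r`. -/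
noncomputable def Protocol.inbox {Out : Type} (Q : Protocol ι Out) (e : Execution ι P κ) (r : ℕ)
    (i j : ι) : Bits :=
  if e.Honest r j then Q.outgoing j (Q.run e r j).1 i else e.adv r j i

theorem Protocol.run_succ {Out : Type} (Q : Protocol ι Out) (e : Execution ι P κ) (r : ℕ) (i : ι) :
    Q.run e (r + 1) i = if (Q.output (Q.run e r i).1).isSome then ((Q.run e r i).1, []) else
      (Q.recv i (Q.run e r i).1 (Q.inbox e r i)).eval e.crypto e.owner i := rfl

theorem Protocol.inbox_of_honest {Out : Type} (Q : Protocol ι Out) {e : Execution ι P κ} {r : ℕ}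
    {j : ι} (h : e.Honest r j) (i : ι) :
    Q.inbox e r i j = Q.outgoing j (Q.run e r j).1 i := if_pos h

end Embed

/-! ### The supersending protocol -/

section Shares

variable {ι : Type} {n : ℕ} (κ L : ℕ)

/-- Split the message `m` into shares and build the Merkle tree over them. The result is the root,
and for each `j` the `j`-th share followed by its siblings. -/
noncomputable def dealShares (n : ℕ) (m : Bits) : Prog ι (Bits × (Fin n → Bits)) :=
  (merkleTree (treeDepth n) (leaves L n m)).bind fun t =>
    .ret (t.1, fun j => shares L n m j ++ t.2 (leafPath n j))

/-- Length of a share together with its siblings. -/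
def certLen (n : ℕ) : ℕ := shareLen L n + treeDepth n * κ

/-- Is `c` a share followed by the siblings that certify it as the `j`-th one below the root `z`? -/
def checkShare (z : Bits) (j : Fin n) (c : Bits) : Prog ι Bool :=
  if c.length = certLen κ L n then
    (merklePath κ (leafPath n j) (c.take (shareLen L n)) (c.drop (shareLen L n))).bind fun h =>
      .ret (decide (h = z))
  else .ret false

open Classical in
/-- Select a valid `j`-th share from the list `cs`; the empty string if there is none. -/
noncomputable def pickShare {k : ℕ} (z : Bits) (j : Fin n) (cs : Fin k → Bits) : Prog ι Bits :=
  (Prog.forFin fun a => checkShare κ L z j (cs a)).bind fun ok =>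
    .ret (if h : ∃ a, ok a = true then cs h.choose else [])

open Classical in
/-- Some message of at most `L` bits that has the given shares, provided these are sufficiently
many to determine it. -/
noncomputable def decodeShares (ok : Fin n → Bool) (cs : Fin n → Bits) : Option Bits :=
  if h : ∃ m : Bits, m.length ≤ L ∧ n / 2 + 1 ≤ (Finset.univ.filter fun j => ok j = true).card ∧
      ∀ j, ok j = true → shares L n m j = (cs j).take (shareLen L n)
  then some h.choose else none

/-- Decode a message from the valid shares among `cs`, and check that `z` is the root of the tree
over its shares. The result contains the message and the certified shares. -/
noncomputable def collectShares (z : Bits) (cs : Fin n → Bits) :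
    Prog ι (Option (Bits × (Fin n → Bits))) :=
  (Prog.forFin fun j => checkShare κ L z j (cs j)).bind fun ok =>
    match decodeShares L ok cs with
    | none => .ret none
    | some m => (dealShares L n m).bind fun t =>
        .ret (if t.1 = z then some (m, t.2) else none)

open Classical in
/-- The value that `f` takes on more than half of the `k` points; the empty string if there is
none. -/
noncomputable def majority {k : ℕ} (f : Fin k → Bits) : Bits :=
  if h : ∃ z, k < 2 * (Finset.univ.filter fun a => f a = z).card then h.choose else []

theorem dealShares_sigFree (m : Bits) : (dealShares L n m : Prog ι _).SigFree :=
  (merkleTree_sigFree _ _).bind fun _ => trivial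

theorem checkShare_sigFree (z : Bits) (j : Fin n) (c : Bits) :
    (checkShare κ L z j c : Prog ι _).SigFree := by
  unfold checkShare
  split_ifs
  · exact (merklePath_sigFree _ _ _).bind fun _ => trivial
  · trivial

theorem pickShare_sigFree {k : ℕ} (z : Bits) (j : Fin n) (cs : Fin k → Bits) :
    (pickShare κ L z j cs : Prog ι _).SigFree :=
  (Prog.SigFree.forFin fun _ => checkShare_sigFree κ L _ _ _).bind fun _ => trivial

theorem collectShares_sigFree (z : Bits) (cs : Fin n → Bits) :
    (collectShares κ L z cs : Prog ι _).SigFree := by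
  refine (Prog.SigFree.forFin fun _ => checkShare_sigFree κ L _ _ _).bind fun ok => ?_
  cases decodeShares L ok cs with
  | none => trivial
  | some m => exact (dealShares_sigFree L m).bind fun _ => trivial

end Shares

/-- States of a party in `supersend`. Here `σ` is the state space of the agreement protocol. -/
inductive SupersendState (σ : Type) (n : ℕ) : Type
  /-- terminated with the given output -/
  | done (o : Option Bits)
  /-- a sender, with the root of its message and the certified shares -/
  | deal (z : Bits) (cs : Fin n → Bits)
  /-- a receiver at the start -/
  | wait
  /-- a receiver with the root sent by a majority and its own certified share -/
  | relay (z own : Bits)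
  /-- a receiver that takes part in the agreement on a root and has completed `r` rounds of it; `c`
  is the root of the message that it decoded, with the certified shares -/
  | root (c : Option (Bits × (Fin n → Bits))) (r : ℕ) (s : σ)
  /-- a receiver that takes part in the agreement on whether some honest receiver knows a message
  with the root `z` and has completed `r` rounds of it; `c` are the certified shares of such a
  message -/
  | known (z : Bits) (c : Option (Fin n → Bits)) (r : ℕ) (s : σ)
  /-- a receiver with the root `z`, the decision of the second agreement and its certified share -/
  | relay' (z : Bits) (go : Bool) (own : Bits)

section Protocol

variable {nA n : ℕ} (Q : Protocol (Fin n) Bits) (κ R L : ℕ)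

/-- One round of the agreement protocol, run as a subprotocol. -/
def subStep (tag : Bool) (b : Fin n) (s : Q.State) (inbox : Fin nA ⊕ Fin n → Bits) :
    Prog (Fin nA ⊕ Fin n) Q.State :=
  if (Q.output s).isSome then .ret s
  else (Q.recv b s fun j => inbox (.inr j)).embed .inr tag

/-- Messages of a receiver in `supersend`. The round after the `R` rounds of the first agreement is
silent: its outcome becomes the input to the second one. In the round after the second agreement,
the receivers that know a message with the agreed root deal its shares. -/
def supersendSend (b j : Fin n) : SupersendState Q.State n → Bits
  | .relay _ own => own
  | .root _ r s => if r < R then Q.outgoing b s j else []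
  | .known _ c r s =>
      if r < R then Q.outgoing b s j
      else if Q.output s = some [true] then c.elim [] fun cs => cs j
      else []
  | .relay' _ _ own => own
  | _ => []

/-- State transitions of a receiver in `supersend`. The input to the first agreement is the root of
the decoded message, or the empty string if there is none; the input to the second one is a single
bit. -/
noncomputable def supersendRecv (b : Fin n) (inbox : Fin nA ⊕ Fin n → Bits) :
    SupersendState Q.State n → Prog (Fin nA ⊕ Fin n) (SupersendState Q.State n)
  | .wait =>
      (pickShare κ L (majority fun a => (inbox (.inl a)).take κ) b
        fun a => (inbox (.inl a)).drop κ).bind fun own =>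
      .ret (.relay (majority fun a => (inbox (.inl a)).take κ) own)
  | .relay z _ =>
      (collectShares κ L z fun j => inbox (.inr j)).bind fun c =>
      ((Q.init b (c.elim [] fun _ => z)).embed .inr false).bind fun s =>
      .ret (.root (c.map fun x => (z, x.2)) 0 s)
  | .root c r s =>
      if r < R then (subStep Q false b s inbox).bind fun s' => .ret (.root c (r + 1) s')
      else
        ((Q.init b [(c.filter fun x => x.1 = (Q.output s).getD []).isSome]).embed .inr true).bind
        fun s' => .ret (.known ((Q.output s).getD [])
          ((c.filter fun x => x.1 = (Q.output s).getD []).map Prod.snd) 0 s')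
  | .known z c r s =>
      if r < R then (subStep Q true b s inbox).bind fun s' => .ret (.known z c (r + 1) s')
      else
        (pickShare κ L z b fun j => inbox (.inr j)).bind fun own =>
        .ret (.relay' z (Q.output s = some [true]) own)
  | .relay' z go _ =>
      (collectShares κ L z fun j => inbox (.inr j)).bind fun c =>
      .ret (.done (if go then c.map Prod.fst else none))
  | _ => .ret (.done none)

/-- The supersending protocol: the senders deal certified shares of their messages, the receivers
exchange the shares that match the root sent by a majority and decode. They agree on a root by an
instance of the agreement protocol `Q`, which takes `R` rounds, and by a second one on whether to
deliver a message with this root. If so, those who know it deal its shares, the receivers exchange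
these and decode. -/
noncomputable def supersend : Protocol (Fin nA ⊕ Fin n) (Option Bits) where
  State := SupersendState Q.State n
  init
    | .inl _, m => (dealShares L n m).bind fun t => .ret (.deal t.1 t.2)
    | .inr _, _ => .ret .wait
  send
    | .inl _, .deal z cs, .inr j => z ++ cs j
    | .inr b, s, .inr j => supersendSend Q R b j s
    | _, _, _ => []
  recv
    | .inl _, _, _ => .ret (.done none)
    | .inr b, s, inbox => supersendRecv Q κ R L b inbox s
  output
    | .done o => some o
    | _ => none

theorem supersend_sigFree (hQ : Q.SigFree) :
    (supersend Q κ R L : Protocol (Fin nA ⊕ Fin n) _).SigFree := by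
  have hstep : ∀ tag b s (inbox : Fin nA ⊕ Fin n → Bits),
      (subStep Q tag b s inbox).SigFree := by
    intro tag b s inbox
    unfold subStep
    split_ifs
    · trivial
    · exact (hQ.2 _ _ _).embed _ _
  refine ⟨?_, ?_⟩
  · rintro (a | b) x
    · exact (dealShares_sigFree L x).bind fun _ => trivial
    · trivial
  · rintro (a | b) s inbox
    · trivial
    · change (supersendRecv Q κ R L b inbox s).SigFree
      cases s with
      | done o => trivial
      | deal z cs => trivial
      | wait => exact (pickShare_sigFree κ L _ _ _).bind fun _ => trivial
      | relay z own =>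
        exact (collectShares_sigFree κ L _ _).bind fun _ =>
          ((hQ.1 _ _).embed _ _).bind fun _ => trivial
      | root c r s =>
        simp only [supersendRecv]
        split_ifs
        · exact (hstep _ _ _ _).bind fun _ => trivial
        · exact ((hQ.1 _ _).embed _ _).bind fun _ => trivial
      | known z c r s =>
        simp only [supersendRecv]
        split_ifs
        · exact (hstep _ _ _ _).bind fun _ => trivial
        · exact (pickShare_sigFree κ L _ _ _).bind fun _ => trivial
      | relay' z go own => exact (collectShares_sigFree κ L _ _).bind fun _ => trivial

end Protocol

/-! ### Executions of the supersending protocol -/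

section Run

variable {nA n κ : ℕ} {P : Type} (Q : Protocol (Fin n) Bits) (R L : ℕ)
  (e : Execution (Fin nA ⊕ Fin n) P κ)

/-- Messages from the senders to the receiver `b`. -/
noncomputable def fromSenders (b : Fin n) (a : Fin nA) : Bits :=
  (supersend Q κ R L).inbox e 0 (.inr b) (.inl a)

/-- Messages from the receivers to the receiver `b` in round `r`. -/
noncomputable def fromReceivers (r : ℕ) (b j : Fin n) : Bits :=
  (supersend Q κ R L).inbox e r (.inr b) (.inr j)

/-- The root sent by a majority of the senders, as seen by `b`. -/
noncomputable def senderRoot (b : Fin n) : Bits :=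
  majority fun a => (fromSenders Q R L e b a).take κ

/-- How `b` selects its share among those sent by the senders. -/
noncomputable def pickProg (b : Fin n) : Prog (Fin nA ⊕ Fin n) Bits :=
  pickShare κ L (senderRoot Q R L e b) b fun a => (fromSenders Q R L e b a).drop κ

/-- How `b` decodes the shares exchanged in round 1. -/
noncomputable def collectProg (b : Fin n) :
    Prog (Fin nA ⊕ Fin n) (Option (Bits × (Fin n → Bits))) :=
  collectShares κ L (senderRoot Q R L e b) (fromReceivers Q R L e 1 b)

/-- The message that `b` decodes from the shares exchanged in round 1, with its shares. -/
noncomputable def decoded (b : Fin n) : Option (Bits × (Fin n → Bits)) :=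
  ((collectProg Q R L e b).eval e.crypto e.owner (.inr b)).1

/-- Input of `b` to the agreement on a root: that of its decoded message, if there is one. -/
noncomputable def rootInput (b : Fin n) : Bits :=
  (decoded Q R L e b).elim [] fun _ => senderRoot Q R L e b

/-- The execution of the agreement on a root. -/
noncomputable def rootExec : Execution (Fin n) P κ :=
  e.sub .inr false 2 (rootInput Q R L e)

/-- The root that `b` obtains from the agreement. -/
noncomputable def agreedRoot (b : Fin n) : Bits :=
  (Q.outputAt (rootExec Q R L e) R b).getD []

/-- The root of the message that `b` decoded, with the certified shares, if it is the agreed one. -/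
noncomputable def knownMessage (b : Fin n) : Option (Bits × (Fin n → Bits)) :=
  ((decoded Q R L e b).map fun x => (senderRoot Q R L e b, x.2)).filter
    fun x => x.1 = agreedRoot Q R L e b

/-- The execution of the agreement on whether to deliver a message with the agreed root. -/
noncomputable def knownExec : Execution (Fin n) P κ :=
  e.sub .inr true (2 + R + 1) fun b => [(knownMessage Q R L e b).isSome]

/-- How `b` selects its share among those dealt by receivers. -/
noncomputable def pickProg' (b : Fin n) : Prog (Fin nA ⊕ Fin n) Bits :=
  pickShare κ L (agreedRoot Q R L e b) b (fromReceivers Q R L e (2 + R + 1 + R) b)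

/-- How `b` finally decodes. -/
noncomputable def collectProg' (b : Fin n) :
    Prog (Fin nA ⊕ Fin n) (Option (Bits × (Fin n → Bits))) :=
  collectShares κ L (agreedRoot Q R L e b) (fromReceivers Q R L e (2 + R + 1 + R + 1) b)

theorem run_sender_zero (a : Fin nA) :
    (supersend Q κ R L).run e 0 (.inl a) =
      let t := (dealShares L n (e.input (.inl a))).eval e.crypto e.owner (.inl a)
      (.deal t.1.1 t.1.2, t.2) := by
  simp [Protocol.run, supersend, Prog.eval_bind, Prog.eval]

theorem run_sender_succ (r : ℕ) (a : Fin nA) :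
    (supersend Q κ R L).run e (r + 1) (.inl a) = (.done none, []) := by
  induction r with
  | zero =>
    rw [Protocol.run_succ, run_sender_zero]
    rfl
  | succ r ih => rw [Protocol.run_succ, ih]; rfl

theorem run_receiver_zero (b : Fin n) :
    (supersend Q κ R L).run e 0 (.inr b) = (.wait, []) := rfl

theorem run_receiver_one (b : Fin n) :
    (supersend Q κ R L).run e 1 (.inr b) =
      let t := (pickProg Q R L e b).eval e.crypto e.owner (.inr b)
      (.relay (senderRoot Q R L e b) t.1, t.2) := by
  rw [Protocol.run_succ, run_receiver_zero, if_neg (by simp [supersend])]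
  change Prog.eval _ _ _ (supersendRecv Q κ R L b _ .wait) = _
  simp only [supersendRecv, Prog.eval_bind, Prog.eval, List.append_nil]
  rfl

theorem eval_subStep {tag : Bool} {T₀ r : ℕ} {input : Fin n → Bits} {b : Fin n}
    {inbox : Fin nA ⊕ Fin n → Bits}
    (h : (fun j => inbox (.inr j)) = Q.inbox (e.sub .inr tag T₀ input) r b) :
    (subStep Q tag b (Q.run (e.sub .inr tag T₀ input) r b).1 inbox).eval
      e.crypto e.owner (.inr b) =
      ((Q.run (e.sub .inr tag T₀ input) (r + 1) b).1,
        (Q.run (e.sub .inr tag T₀ input) (r + 1) b).2.map (Query.embed .inr tag)) := by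
  rw [Protocol.run_succ, subStep]
  split_ifs with ho
  · rfl
  · rw [h, Prog.eval_embed e .inr tag T₀ input]

/-- During the agreement on a root, the receivers run `rootExec`. -/
theorem run_root (r : ℕ) (hr : r ≤ R) (b : Fin n) :
    (supersend Q κ R L).run e (2 + r) (.inr b) =
      (.root ((decoded Q R L e b).map fun x => (senderRoot Q R L e b, x.2)) r
        (Q.run (rootExec Q R L e) r b).1,
      (if r = 0 then ((collectProg Q R L e b).eval e.crypto e.owner (.inr b)).2 else []) ++
        (Q.run (rootExec Q R L e) r b).2.map (Query.embed .inr false)) := by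
  induction r generalizing b with
  | zero =>
    rw [if_pos rfl]
    change (supersend Q κ R L).run e (1 + 1) (.inr b) = _
    rw [Protocol.run_succ, run_receiver_one, if_neg (by simp [supersend])]
    change Prog.eval _ _ _ (supersendRecv Q κ R L b _ (.relay _
      ((pickProg Q R L e b).eval e.crypto e.owner (.inr b)).1)) = _
    simp only [supersendRecv, Prog.eval_bind, Prog.eval, List.append_nil,
      Prog.eval_embed e .inr false 2 (rootInput Q R L e)]
    rfl
  | succ r ih =>
    have hin : (fun j => (supersend Q κ R L).inbox e (2 + r) (.inr b) (.inr j)) =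
        Q.inbox (rootExec Q R L e) r b := by
      funext j
      by_cases h : e.Honest (2 + r) (.inr j)
      · rw [Protocol.inbox_of_honest _ h,
          Protocol.inbox_of_honest Q (show (rootExec Q R L e).Honest r j from h), ih (by omega) j]
        simp [Protocol.outgoing, supersend, supersendSend, show r < R by omega]
      · exact (if_neg h).trans (if_neg (show ¬ (rootExec Q R L e).Honest r j from h)).symm
    rw [← Nat.add_assoc, Protocol.run_succ, ih (by omega), if_neg (by simp [supersend])]
    change Prog.eval _ _ _ (supersendRecv Q κ R L b _ (.root _ _ _)) = _
    simp only [supersendRecv, if_pos (show r < R by omega), Prog.eval_bind, Prog.eval,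
      List.append_nil]
    rw [rootExec, eval_subStep Q e hin]
    simp only [Nat.add_eq_zero_iff, one_ne_zero, and_false, if_false, List.nil_append]
    rfl

/-- During the second agreement, the receivers run `knownExec`. -/
theorem run_known (r : ℕ) (hr : r ≤ R) (b : Fin n) :
    (supersend Q κ R L).run e (2 + R + 1 + r) (.inr b) =
      (.known (agreedRoot Q R L e b) ((knownMessage Q R L e b).map Prod.snd) r
        (Q.run (knownExec Q R L e) r b).1,
      (Q.run (knownExec Q R L e) r b).2.map (Query.embed .inr true)) := by
  induction r generalizing b with
  | zero =>
    change (supersend Q κ R L).run e (2 + R + 1) (.inr b) = _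
    rw [Protocol.run_succ, run_root Q R L e R le_rfl, if_neg (by simp [supersend])]
    change Prog.eval _ _ _ (supersendRecv Q κ R L b _ (.root _ _ _)) = _
    simp only [supersendRecv, lt_irrefl, if_false, Prog.eval_bind, Prog.eval, List.append_nil,
      Prog.eval_embed e .inr true (2 + R + 1) fun b => [(knownMessage Q R L e b).isSome]]
    rfl
  | succ r ih =>
    have hin : (fun j => (supersend Q κ R L).inbox e (2 + R + 1 + r) (.inr b) (.inr j)) =
        Q.inbox (knownExec Q R L e) r b := by
      funext j
      by_cases h : e.Honest (2 + R + 1 + r) (.inr j)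
      · rw [Protocol.inbox_of_honest _ h,
          Protocol.inbox_of_honest Q (show (knownExec Q R L e).Honest r j from h), ih (by omega) j]
        simp [Protocol.outgoing, supersend, supersendSend, show r < R by omega]
      · exact (if_neg h).trans (if_neg (show ¬ (knownExec Q R L e).Honest r j from h)).symm
    rw [← Nat.add_assoc, Protocol.run_succ, ih (by omega), if_neg (by simp [supersend])]
    change Prog.eval _ _ _ (supersendRecv Q κ R L b _ (.known _ _ _ _)) = _
    simp only [supersendRecv, if_pos (show r < R by omega), Prog.eval_bind, Prog.eval,
      List.append_nil]
    rw [knownExec, eval_subStep Q e hin]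
    rfl

theorem run_relay' (b : Fin n) :
    (supersend Q κ R L).run e (2 + R + 1 + R + 1) (.inr b) =
      let t := (pickProg' Q R L e b).eval e.crypto e.owner (.inr b)
      (.relay' (agreedRoot Q R L e b) (Q.outputAt (knownExec Q R L e) R b = some [true]) t.1,
        t.2) := by
  rw [Protocol.run_succ, run_known Q R L e R le_rfl, if_neg (by simp [supersend])]
  change Prog.eval _ _ _ (supersendRecv Q κ R L b _ (.known _ _ _ _)) = _
  simp only [supersendRecv, lt_irrefl, if_false, Prog.eval_bind, Prog.eval, List.append_nil]
  rfl

theorem run_done (b : Fin n) :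
    (supersend Q κ R L).run e (2 + R + 1 + R + 2) (.inr b) =
      let t := (collectProg' Q R L e b).eval e.crypto e.owner (.inr b)
      (.done (if Q.outputAt (knownExec Q R L e) R b = some [true] then t.1.map Prod.fst
        else none), t.2) := by
  change (supersend Q κ R L).run e (2 + R + 1 + R + 1 + 1) (.inr b) = _
  rw [Protocol.run_succ, run_relay', if_neg (by simp [supersend])]
  change Prog.eval _ _ _ (supersendRecv Q κ R L b _ (.relay' _ _
    ((pickProg' Q R L e b).eval e.crypto e.owner (.inr b)).1)) = _
  simp only [supersendRecv, Prog.eval_bind, Prog.eval, List.append_nil, decide_eq_true_eq]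
  rfl

end Run

/-! ### Certified shares -/

section Certified

variable {ι P : Type} {κ L n : ℕ} (E : Crypto ι P κ) (owner : ι → P) (me me' : ι)

theorem length_dealShares_root (m : Bits) :
    ((dealShares L n m).eval E owner me).1.1.length = κ := by
  simp [dealShares, Prog.eval_bind, Prog.eval, length_merkleTree_root]

theorem length_dealShares_cert (m : Bits) (j : Fin n) :
    (((dealShares L n m).eval E owner me).1.2 j).length = certLen κ L n := by
  simp [dealShares, Prog.eval_bind, Prog.eval, certLen, length_shares,
    length_merkleTree_siblings]

theorem checkShare_eq_true {z : Bits} {j : Fin n} {c : Bits} :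
    ((checkShare κ L z j c).eval E owner me).1 = true ↔
      c.length = certLen κ L n ∧
      ((merklePath κ (leafPath n j) (c.take (shareLen L n)) (c.drop (shareLen L n))).eval
        E owner me).1 = z := by
  unfold checkShare
  split_ifs with h <;> simp [Prog.eval_bind, Prog.eval, h]

theorem checkShare_dealShares (m : Bits) (j : Fin n) :
    ((checkShare κ L ((dealShares L n m).eval E owner me').1.1 j
      (((dealShares L n m).eval E owner me').1.2 j)).eval E owner me).1 = true := by
  refine (checkShare_eq_true E owner me).2 ⟨length_dealShares_cert E owner me' m j, ?_⟩
  simp only [dealShares, Prog.eval_bind, Prog.eval]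
  rw [List.take_left' (length_shares L n m j), List.drop_left' (length_shares L n m j),
    ← leaves_leafPath]
  exact merklePath_of_merkleTree E owner me me' _ _ _ (length_leafPath n j)

/-- Below the root for `m`, only the shares of `m` are accepted. -/
theorem share_eq_of_checkShare {m z : Bits} {j : Fin n} {c : Bits}
    (hz : ((dealShares L n m).eval E owner me').1.1 = z)
    (hcf : ∀ y y', Query.hash y ∈ ((dealShares L n m).eval E owner me').2 →
      Query.hash y' ∈ ((checkShare κ L z j c).eval E owner me).2 →
      E.hash y = E.hash y' → y = y')
    (h : ((checkShare κ L z j c).eval E owner me).1 = true) :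
    shares L n m j = c.take (shareLen L n) := by
  obtain ⟨hc, hp⟩ := (checkShare_eq_true E owner me).1 h
  simp only [dealShares, checkShare, if_pos hc, Prog.eval_bind, Prog.eval, List.append_nil]
    at hcf hz
  rw [← leaves_leafPath]
  exact merkle_binding E owner me' me _ _ _ _ _ (length_leafPath n j) hcf (hz.trans hp.symm)

/-- A party that receives a valid share selects a valid one, possibly another. -/
theorem pickShare_valid {k : ℕ} {z : Bits} {j : Fin n} {cs : Fin k → Bits} (a : Fin k)
    (h : ((checkShare κ L z j (cs a)).eval E owner me).1 = true) :
    ((checkShare κ L z j ((pickShare κ L z j cs).eval E owner me).1).eval E owner me').1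
      = true := by
  have hex : ∃ a, ((checkShare κ L z j (cs a)).eval E owner me).1 = true := ⟨a, h⟩
  simp only [pickShare, Prog.eval_bind, Prog.eval, Prog.eval_forFin_fst, dif_pos hex]
  rw [(checkShare_sigFree κ L _ _ _).eval_eq E owner me' me]
  exact hex.choose_spec

theorem length_pickShare_le {k : ℕ} {z : Bits} {j : Fin n} {cs : Fin k → Bits} :
    ((pickShare κ L z j cs).eval E owner me).1.length ≤ certLen κ L n := by
  simp only [pickShare, Prog.eval_bind, Prog.eval, Prog.eval_forFin_fst]
  split_ifs with h
  · exact ((checkShare_eq_true E owner me).1 h.choose_spec).1.le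
  · simp

theorem decodeShares_eq_some {ok : Fin n → Bool} {cs : Fin n → Bits} {m : Bits}
    (h : decodeShares L ok cs = some m) : m.length ≤ L := by
  unfold decodeShares at h
  split_ifs at h with hex
  rw [← Option.some.inj h]
  exact hex.choose_spec.1

theorem decodeShares_of_share_eq {ok : Fin n → Bool} {cs : Fin n → Bits} {m : Bits}
    (hm : m.length ≤ L) (hk : n / 2 + 1 ≤ (Finset.univ.filter fun j => ok j = true).card)
    (h : ∀ j, ok j = true → shares L n m j = (cs j).take (shareLen L n)) :
    decodeShares L ok cs = some m := by
  have hex : ∃ m : Bits, m.length ≤ L ∧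
      n / 2 + 1 ≤ (Finset.univ.filter fun j => ok j = true).card ∧
      ∀ j, ok j = true → shares L n m j = (cs j).take (shareLen L n) := ⟨m, hm, hk, h⟩
  rw [decodeShares, dif_pos hex]
  obtain ⟨hm', -, h'⟩ := hex.choose_spec
  refine congrArg some (eq_of_shares_eq hm' hm hk fun j hj => ?_)
  have hj := (Finset.mem_filter.1 hj).2
  rw [h' j hj, h j hj]

theorem collectShares_eq_some {z : Bits} {cs : Fin n → Bits} {x : Bits × (Fin n → Bits)}
    (h : ((collectShares κ L z cs).eval E owner me).1 = some x) :
    x.1.length ≤ L ∧ ((dealShares L n x.1).eval E owner me).1 = (z, x.2) ∧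
      ∀ y, y ∈ ((dealShares L n x.1).eval E owner me).2 →
        y ∈ ((collectShares κ L z cs).eval E owner me).2 := by
  simp only [collectShares, Prog.eval_bind] at h ⊢
  split at h
  · simp [Prog.eval] at h
  · next m hd =>
    have hm := decodeShares_eq_some hd
    simp only [Prog.eval_bind, Prog.eval] at h
    split_ifs at h with hz
    obtain rfl := Option.some.inj h
    simp only [Prog.eval_bind, Prog.eval]
    refine ⟨hm, by rw [← hz], fun y hy => ?_⟩
    simp [hy]

/-- If `z` is the root for `m`, and no collision occurs, then more than half of the certified
shares of `m` suffice to collect `m`, whatever else is received. -/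
theorem collectShares_of_valid {z m : Bits} {cs : Fin n → Bits} (hm : m.length ≤ L)
    (hz : ((dealShares L n m).eval E owner me').1.1 = z)
    (hcf : ∀ y y', Query.hash y ∈ ((dealShares L n m).eval E owner me').2 →
      Query.hash y' ∈ ((collectShares κ L z cs).eval E owner me).2 →
      E.hash y = E.hash y' → y = y')
    {s : Finset (Fin n)} (hs : n < 2 * s.card)
    (h : ∀ j ∈ s, ((checkShare κ L z j (cs j)).eval E owner me).1 = true) :
    ((collectShares κ L z cs).eval E owner me).1 =
      some (m, ((dealShares L n m).eval E owner me').1.2) := by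
  have hd : decodeShares L (fun j => ((checkShare κ L z j (cs j)).eval E owner me).1) cs =
      some m := by
    refine decodeShares_of_share_eq hm ?_ fun j hj => ?_
    · have : s.card ≤ (Finset.univ.filter fun j =>
          ((checkShare κ L z j (cs j)).eval E owner me).1 = true).card :=
        Finset.card_le_card fun j hj => by simp [h j hj]
      omega
    · refine share_eq_of_checkShare E owner me me' hz (fun y y' hy hy' => hcf y y' hy ?_) hj
      simp only [collectShares, Prog.eval_bind, List.mem_append]
      exact Or.inl (Prog.mem_eval_forFin E owner me j hy')
  simp only [collectShares, Prog.eval_bind, Prog.eval_forFin_fst, hd, Prog.eval]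
  rw [(dealShares_sigFree L m).eval_eq E owner me me', if_pos hz]

theorem numQueries_dealShares_le (m : Bits) :
    ((dealShares L n m).eval E owner me).2.length ≤ 2 * 2 ^ treeDepth n := by
  have := numQueries_merkleTree E owner me (treeDepth n) (leaves L n m)
  simp only [dealShares, Prog.eval_bind, Prog.eval, List.append_nil]
  omega

theorem numQueries_checkShare_le (z : Bits) (j : Fin n) (c : Bits) :
    ((checkShare κ L z j c).eval E owner me).2.length ≤ treeDepth n + 1 := by
  unfold checkShare
  split_ifs
  · simp [Prog.eval_bind, Prog.eval, numQueries_merklePath, length_leafPath]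
  · simp [Prog.eval]

theorem numQueries_pickShare_le {k : ℕ} (z : Bits) (j : Fin n) (cs : Fin k → Bits) :
    ((pickShare κ L z j cs).eval E owner me).2.length ≤ k * (treeDepth n + 1) := by
  simp only [pickShare, Prog.eval_bind, Prog.eval, List.append_nil]
  exact Prog.length_eval_forFin_le E owner me fun a => numQueries_checkShare_le E owner me _ _ _

theorem numQueries_collectShares_le (z : Bits) (cs : Fin n → Bits) :
    ((collectShares κ L z cs).eval E owner me).2.length ≤
      n * (treeDepth n + 1) + 2 * 2 ^ treeDepth n := by
  simp only [collectShares, Prog.eval_bind, List.length_append]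
  refine Nat.add_le_add (Prog.length_eval_forFin_le E owner me fun j =>
    numQueries_checkShare_le E owner me _ _ _) ?_
  cases decodeShares L _ cs with
  | none => simp [Prog.eval]
  | some m =>
    simpa [Prog.eval_bind, Prog.eval] using numQueries_dealShares_le E owner me m

theorem majority_eq {k : ℕ} {f : Fin k → Bits} {z : Bits}
    (h : k < 2 * (Finset.univ.filter fun a => f a = z).card) : majority f = z := by
  have hex : ∃ z, k < 2 * (Finset.univ.filter fun a => f a = z).card := ⟨z, h⟩
  rw [majority, dif_pos hex]
  by_contra hne
  have hdisj : Disjoint (Finset.univ.filter fun a => f a = hex.choose)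
      (Finset.univ.filter fun a => f a = z) :=
    Finset.disjoint_filter.2 fun a _ h1 h2 => hne (h1.symm.trans h2)
  have h1 := hex.choose_spec
  have h2 := Finset.card_le_univ ((Finset.univ.filter fun a => f a = hex.choose) ∪
    (Finset.univ.filter fun a => f a = z))
  rw [Finset.card_union_of_disjoint hdisj, Fintype.card_fin] at h2
  omega

theorem length_majority_le {k c : ℕ} {f : Fin k → Bits} (h : ∀ a, (f a).length ≤ c) :
    (majority f).length ≤ c := by
  unfold majority
  split_ifs with hex
  · have h1 := hex.choose_spec
    obtain ⟨a, ha⟩ := Finset.card_pos.1 (show 0 <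
      (Finset.univ.filter fun a => f a = hex.choose).card by omega)
    rw [← (Finset.mem_filter.1 ha).2]
    exact h a
  · simp

end Certified

/-! ### Executions without collisions and forgeries -/

/-- A subprotocol inherits the absence of collisions and forgeries if its operations are among those
of the whole protocol, and if strings with its prefix are signed nowhere else. -/
theorem Protocol.clean_sub {ι ι' P Out Out' : Type} {κ T R T₀ : ℕ} {S : Protocol ι' Out'}
    {Q : Protocol ι Out} {e : Execution ι' P κ} {g : ι → ι'} {c : Bool}
    {input : ι → Bits} (h : S.Clean e T) (hT : T₀ + R ≤ T)
    (hq : ∀ r ≤ R, ∀ i, ∀ x ∈ Q.queriesAt (e.sub g c T₀ input) r i,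
      x.embed g c ∈ S.queriesAt e (T₀ + r) (g i))
    (hsign : ∀ r ≤ T, ∀ i x, Query.sign (c :: x) ∈ S.queriesAt e r (g i) →
      ∃ r', r = T₀ + r' ∧ Query.sign x ∈ Q.queriesAt (e.sub g c T₀ input) r' i)
    (hg : Function.Injective g) :
    Q.Clean (e.sub g c T₀ input) R := by
  refine ⟨fun r hr r' hr' i i' x x' hi hi' hx hx' => ?_, fun r hr i j x sig hi hj hx => ?_⟩
  · exact h.1 (T₀ + r) (by omega) (T₀ + r') (by omega) (g i) (g i') x x' hi hi'
      (hq r hr i _ hx) (hq r' hr' i' _ hx')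
  · obtain ⟨r', hr', hs⟩ := h.2 (T₀ + r) (by omega) (g i) (g j) (c :: x) sig hi hj
      (hq r hr i _ hx)
    obtain ⟨r'', rfl, hs'⟩ := hsign r' (by omega) j x hs
    exact ⟨r'', hr'.imp (by omega) (fun ⟨h1, h2⟩ => ⟨by omega, hg h2⟩), hs'⟩

section Clean

variable {nA n κ : ℕ} {P : Type} {Q : Protocol (Fin n) Bits} {R L : ℕ}
  {e : Execution (Fin nA ⊕ Fin n) P κ}

/-- Receivers sign strings only within the two agreements. -/
theorem sign_mem_queriesAt {r : ℕ} (hr : r ≤ 2 + R + 1 + R + 2) {b : Fin n} {y : Bits}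
    (h : Query.sign y ∈ (supersend Q κ R L).queriesAt e r (.inr b)) :
    (∃ r' x, r = 2 + r' ∧ y = false :: x ∧
      Query.sign x ∈ Q.queriesAt (rootExec Q R L e) r' b) ∨
    ∃ r' x, r = 2 + R + 1 + r' ∧ y = true :: x ∧
      Query.sign x ∈ Q.queriesAt (knownExec Q R L e) r' b := by
  have hembed : ∀ (tag : Bool) (l : List (Query (Fin n))),
      Query.sign y ∈ l.map (Query.embed (Sum.inr : Fin n → Fin nA ⊕ Fin n) tag) →
      ∃ x, y = tag :: x ∧ Query.sign x ∈ l := by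
    intro tag l hl
    obtain ⟨q, hq, hqe⟩ := List.mem_map.1 hl
    cases q with
    | sign x => exact ⟨x, by simpa [Query.embed] using hqe.symm, hq⟩
    | hash x => simp [Query.embed] at hqe
    | verify => simp [Query.embed] at hqe
  have hcases : r = 0 ∨ r = 1 ∨ (∃ r' ≤ R, r = 2 + r') ∨ (∃ r' ≤ R, r = 2 + R + 1 + r') ∨
      r = 2 + R + 1 + R + 1 ∨ r = 2 + R + 1 + R + 2 := by
    rcases (by omega : r = 0 ∨ r = 1 ∨ (2 ≤ r ∧ r ≤ 2 + R) ∨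
      (2 + R + 1 ≤ r ∧ r ≤ 2 + R + 1 + R) ∨
      r = 2 + R + 1 + R + 1 ∨ r = 2 + R + 1 + R + 2) with h | h | h | h | h | h
    · exact .inl h
    · exact .inr (.inl h)
    · exact .inr (.inr (.inl ⟨r - 2, by omega, by omega⟩))
    · exact .inr (.inr (.inr (.inl ⟨r - (2 + R + 1), by omega, by omega⟩)))
    · exact .inr (.inr (.inr (.inr (.inl h))))
    · exact .inr (.inr (.inr (.inr (.inr h))))
  unfold Protocol.queriesAt at h
  rcases hcases with rfl | rfl | ⟨r', hr', rfl⟩ | ⟨r', hr', rfl⟩ | rfl | rfl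
  · simp [run_receiver_zero] at h
  · rw [run_receiver_one] at h
    exact absurd h ((pickShare_sigFree κ L _ _ _).not_sign _ _ _ _)
  · rw [run_root Q R L e r' hr'] at h
    rcases List.mem_append.1 h with h | h
    · split_ifs at h
      · exact absurd h ((collectShares_sigFree κ L _ _).not_sign _ _ _ _)
      · simp at h
    · obtain ⟨x, hx, hx'⟩ := hembed _ _ h
      exact .inl ⟨r', x, rfl, hx, hx'⟩
  · rw [run_known Q R L e r' hr'] at h
    obtain ⟨x, hx, hx'⟩ := hembed _ _ h
    exact .inr ⟨r', x, rfl, hx, hx'⟩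
  · rw [run_relay'] at h
    exact absurd h ((pickShare_sigFree κ L _ _ _).not_sign _ _ _ _)
  · rw [run_done] at h
    exact absurd h ((collectShares_sigFree κ L _ _).not_sign _ _ _ _)

theorem clean_rootExec (h : (supersend Q κ R L).Clean e (2 + R + 1 + R + 2)) :
    Q.Clean (rootExec Q R L e) R := by
  refine Protocol.clean_sub h (by omega) (fun r hr i x hx => ?_) (fun r hr i x hx => ?_) Sum.inr_injective
  · rw [Protocol.queriesAt, run_root Q R L e r hr]
    exact List.mem_append_right _ (List.mem_map_of_mem hx)
  · rcases sign_mem_queriesAt hr hx with ⟨r', y, hr', hy, h⟩ | ⟨r', y, hr', hy, h⟩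
    · obtain rfl : x = y := by simpa using hy
      exact ⟨r', hr', h⟩
    · simp at hy

theorem clean_knownExec (h : (supersend Q κ R L).Clean e (2 + R + 1 + R + 2)) :
    Q.Clean (knownExec Q R L e) R := by
  refine Protocol.clean_sub h (by omega) (fun r hr i x hx => ?_) (fun r hr i x hx => ?_) Sum.inr_injective
  · rw [Protocol.queriesAt, run_known Q R L e r hr]
    exact List.mem_map_of_mem hx
  · rcases sign_mem_queriesAt hr hx with ⟨r', y, hr', hy, h⟩ | ⟨r', y, hr', hy, h⟩
    · simp at hy
    · obtain rfl : x = y := by simpa using hy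
      exact ⟨r', hr', h⟩

theorem inputsAtMost_rootExec : (rootExec Q R L e).InputsAtMost κ := by
  intro b _
  change (rootInput Q R L e b).length ≤ κ
  unfold rootInput
  cases decoded Q R L e b with
  | none => simp
  | some x => exact length_majority_le fun a => by simp

theorem inputsAtMost_knownExec (hκ : 1 ≤ κ) : (knownExec Q R L e).InputsAtMost κ :=
  fun _ _ => hκ

end Clean

/-! ### Termination, agreement and delivery -/

section Correctness

variable {nA n κ : ℕ} {P : Type} {Q : Protocol (Fin n) Bits} {R L : ℕ}
  {e : Execution (Fin nA ⊕ Fin n) P κ}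

theorem outputAt_sender (r : ℕ) (a : Fin nA) :
    (supersend Q κ R L).outputAt e (r + 1) (.inl a) = some none := by
  rw [Protocol.outputAt, run_sender_succ]; rfl

theorem outputAt_receiver (b : Fin n) :
    (supersend Q κ R L).outputAt e (2 + R + 1 + R + 2) (.inr b) =
      some (if Q.outputAt (knownExec Q R L e) R b = some [true] then
        (((collectProg' Q R L e b).eval e.crypto e.owner (.inr b)).1).map Prod.fst
        else none) := by
  rw [Protocol.outputAt, run_done]; rfl

theorem terminates_supersend :
    (supersend Q κ R L).Terminates e (2 + R + 1 + R + 2) := by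
  rintro (a | b) -
  · rw [outputAt_sender (2 + R + 1 + R + 1)]; rfl
  · rw [outputAt_receiver]; rfl

theorem length_output_le {b : Fin n} {m : Bits}
    (h : (if Q.outputAt (knownExec Q R L e) R b = some [true] then
        (((collectProg' Q R L e b).eval e.crypto e.owner (.inr b)).1).map Prod.fst
        else none) = some m) : m.length ≤ L := by
  split_ifs at h
  obtain ⟨x, hx, rfl⟩ := Option.map_eq_some_iff.1 h
  exact (collectShares_eq_some _ _ _ hx).1

theorem fromSenders_of_honest {a : Fin nA} (h : e.Honest 0 (.inl a)) (b : Fin n) :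
    fromSenders Q R L e b a =
      ((dealShares L n (e.input (.inl a))).eval e.crypto e.owner (.inl a)).1.1 ++
      ((dealShares L n (e.input (.inl a))).eval e.crypto e.owner (.inl a)).1.2 b := by
  rw [fromSenders, Protocol.inbox_of_honest _ h, run_sender_zero]
  rfl

theorem fromReceivers_one {j : Fin n} (h : e.Honest 1 (.inr j)) (b : Fin n) :
    fromReceivers Q R L e 1 b j = ((pickProg Q R L e j).eval e.crypto e.owner (.inr j)).1 := by
  rw [fromReceivers, Protocol.inbox_of_honest _ h, run_receiver_one]
  rfl

theorem fromReceivers_deal {j : Fin n} (h : e.Honest (2 + R + 1 + R) (.inr j))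
    (ho : Q.outputAt (knownExec Q R L e) R j = some [true])
    {x : Bits × (Fin n → Bits)} (hx : knownMessage Q R L e j = some x) (b : Fin n) :
    fromReceivers Q R L e (2 + R + 1 + R) b j = x.2 b := by
  rw [fromReceivers, Protocol.inbox_of_honest _ h, run_known Q R L e R le_rfl, hx]
  unfold Protocol.outputAt at ho
  simp [Protocol.outgoing, supersend, supersendSend, ho]

theorem fromReceivers_relay {j : Fin n} (h : e.Honest (2 + R + 1 + R + 1) (.inr j)) (b : Fin n) :
    fromReceivers Q R L e (2 + R + 1 + R + 1) b j =
      ((pickProg' Q R L e j).eval e.crypto e.owner (.inr j)).1 := by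
  rw [fromReceivers, Protocol.inbox_of_honest _ h, run_relay']
  rfl

theorem collectProg_queries {b : Fin n} {x : Query (Fin nA ⊕ Fin n)}
    (h : x ∈ ((collectProg Q R L e b).eval e.crypto e.owner (.inr b)).2) :
    x ∈ (supersend Q κ R L).queriesAt e 2 (.inr b) := by
  rw [Protocol.queriesAt, run_root Q R L e 0 (Nat.zero_le R), if_pos rfl]
  exact List.mem_append_left _ h

theorem collectProg'_queries {b : Fin n} {x : Query (Fin nA ⊕ Fin n)}
    (h : x ∈ ((collectProg' Q R L e b).eval e.crypto e.owner (.inr b)).2) :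
    x ∈ (supersend Q κ R L).queriesAt e (2 + R + 1 + R + 2) (.inr b) := by
  rw [Protocol.queriesAt, run_done]
  exact h

open Classical in
/-- If an honest majority of the senders holds `m`, then every honest receiver accepts the root for
`m` as that of a majority, and decodes `m` from the shares exchanged in round 1. -/
theorem decoded_of_majority (hclean : (supersend Q κ R L).Clean e (2 + R + 1 + R + 2))
    {T : ℕ} (hT : 1 ≤ T)
    (hB : n < 2 * (Finset.univ.filter fun b : Fin n => e.Honest T (.inr b)).card)
    {m : Bits} (hm : m.length ≤ L)
    (hA : nA < 2 * (Finset.univ.filter fun a : Fin nA =>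
      e.Honest T (.inl a) ∧ e.input (.inl a) = m).card) :
    ∃ z, (∀ b, senderRoot Q R L e b = z) ∧
      ∀ b, e.Honest 2 (.inr b) → ∃ cs, decoded Q R L e b = some (m, cs) := by
  obtain ⟨a, ha⟩ := Finset.card_pos.1 (show 0 < (Finset.univ.filter fun a : Fin nA =>
    e.Honest T (.inl a) ∧ e.input (.inl a) = m).card by omega)
  obtain ⟨haT, ham⟩ := (Finset.mem_filter.1 ha).2
  set t := (dealShares L n m).eval e.crypto e.owner (Sum.inl a : Fin nA ⊕ Fin n) with ht
  have hsent : ∀ b a', e.Honest T (.inl a') → e.input (.inl a') = m →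
      fromSenders Q R L e b a' = t.1.1 ++ t.1.2 b := by
    intro b a' h1 h2
    rw [fromSenders_of_honest (h1.anti (Nat.zero_le T)), h2,
      (dealShares_sigFree L m).eval_eq e.crypto e.owner (Sum.inl a') (Sum.inl a)]
  have hlen : t.1.1.length = κ := length_dealShares_root _ _ _ m
  have hroot : ∀ b, senderRoot Q R L e b = t.1.1 := by
    intro b
    refine majority_eq (hA.trans_le (Nat.mul_le_mul_left 2 (Finset.card_le_card fun a' ha' => ?_)))
    obtain ⟨h1, h2⟩ := (Finset.mem_filter.1 ha').2
    simp [hsent b a' h1 h2, List.take_left' hlen]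
  refine ⟨t.1.1, hroot, fun b hb => ⟨t.1.2, ?_⟩⟩
  have hmem : ∀ y ∈ t.2, y ∈ (supersend Q κ R L).queriesAt e 0 (.inl a) := by
    intro y hy
    rw [Protocol.queriesAt, run_sender_zero, ham]
    exact hy
  unfold decoded collectProg
  refine collectShares_of_valid e.crypto e.owner (.inr b) (.inl a) hm (hroot b).symm ?_ hB ?_
  · intro y y' hy hy' heq
    exact hclean.1 0 (by omega) 2 (by omega) (.inl a) (.inr b) y y'
      (haT.anti (Nat.zero_le T)) hb (hmem _ hy) (collectProg_queries hy') heq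
  · intro j hj
    have hj := (Finset.mem_filter.1 hj).2
    rw [fromReceivers_one (hj.anti hT), hroot b, ← hroot j]
    refine pickShare_valid e.crypto e.owner (.inr j) (.inr b) a ?_
    rw [hroot j, hsent j a haT ham, List.drop_left' hlen]
    exact checkShare_dealShares e.crypto e.owner _ _ m j

theorem numIn_mono {ι : Type} [Fintype ι] (owner : ι → P) {C D : Set P} (h : C ⊆ D) :
    numIn owner C ≤ numIn owner D := by
  classical
  unfold numIn
  exact Finset.card_le_card fun i hi => by
    simp only [Finset.mem_filter, Finset.mem_univ, true_and] at hi ⊢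
    exact h hi

theorem rootExec_spec {t : ℕ}
    (hBA : ∀ owner : Fin n → P, AchievesBAIn Q κ κ t R owner)
    (hclean : (supersend Q κ R L).Clean e (2 + R + 1 + R + 2))
    (ht : numIn (fun b : Fin n => e.owner (.inr b)) (e.corrupt (2 + R + 1 + R + 2)) ≤ t) :
    Q.Valid (rootExec Q R L e) R ∧ Q.Agrees (rootExec Q R L e) R :=
  (hBA _ _ rfl inputsAtMost_rootExec ((numIn_mono _ (e.corrupt_mono (by omega))).trans ht)
    (clean_rootExec hclean)).2

theorem knownExec_spec {t : ℕ}
    (hBA : ∀ owner : Fin n → P, AchievesBAIn Q κ κ t R owner)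
    (hκ : 1 ≤ κ) (hclean : (supersend Q κ R L).Clean e (2 + R + 1 + R + 2))
    (ht : numIn (fun b : Fin n => e.owner (.inr b)) (e.corrupt (2 + R + 1 + R + 2)) ≤ t) :
    Q.Valid (knownExec Q R L e) R ∧ Q.Agrees (knownExec Q R L e) R :=
  (hBA _ _ rfl (inputsAtMost_knownExec hκ) ((numIn_mono _ (e.corrupt_mono (by omega))).trans ht)
    (clean_knownExec hclean)).2

open Classical in
/-- If the receivers agree to deliver, then all honest receivers finally collect a message `m` that
some receiver `i` decoded in round 1 while it was honest. -/
theorem collect_of_go {t : ℕ}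
    (hBA : ∀ owner : Fin n → P, AchievesBAIn Q κ κ t R owner)
    (hκ : 1 ≤ κ) (hclean : (supersend Q κ R L).Clean e (2 + R + 1 + R + 2))
    (ht : numIn (fun b : Fin n => e.owner (.inr b)) (e.corrupt (2 + R + 1 + R + 2)) ≤ t)
    (hB : n < 2 * (Finset.univ.filter fun b : Fin n =>
      e.Honest (2 + R + 1 + R + 2) (.inr b)).card)
    {b₀ : Fin n} (hb₀ : e.Honest (2 + R + 1 + R + 2) (.inr b₀))
    (hgo : Q.outputAt (knownExec Q R L e) R b₀ = some [true]) :
    ∃ i m cs, e.Honest 2 (.inr i) ∧ decoded Q R L e i = some (m, cs) ∧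
      ∀ b, e.Honest (2 + R + 1 + R + 2) (.inr b) →
        (((collectProg' Q R L e b).eval e.crypto e.owner (.inr b)).1).map Prod.fst = some m := by
  obtain ⟨-, hagree⟩ := rootExec_spec hBA hclean ht
  obtain ⟨hvalid', hagree'⟩ := knownExec_spec hBA hκ hclean ht
  -- otherwise all honest receivers would have had the input `[false]`
  obtain ⟨i, hi, hknown⟩ : ∃ i, e.Honest (2 + R + 1 + R) (.inr i) ∧
      (knownMessage Q R L e i).isSome := by
    by_contra! hno
    have := hvalid' [false] (fun i hi => by
      simpa [knownExec, Execution.sub] using hno i hi) b₀ (hb₀.anti (by omega))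
    rw [hgo] at this
    simp at this
  obtain ⟨x, hx⟩ := Option.isSome_iff_exists.1 hknown
  obtain ⟨hx', hxz⟩ := Option.filter_eq_some_iff.1 hx
  obtain ⟨⟨m, cs⟩, hdec, rfl⟩ := Option.map_eq_some_iff.1 hx'
  have hxz : senderRoot Q R L e i = agreedRoot Q R L e i := by simpa using hxz
  have hroot : ∀ b, e.Honest (2 + R) (.inr b) → agreedRoot Q R L e b = senderRoot Q R L e i := by
    intro b hb
    rw [hxz, agreedRoot, agreedRoot, hagree b i hb (hi.anti (by omega))]
  have hi2 : e.Honest 2 (.inr i) := hi.anti (by omega)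
  have hgoi := (hagree' i b₀ hi (hb₀.anti (by omega))).trans hgo
  obtain ⟨hm, hdeal, hsub⟩ := collectShares_eq_some e.crypto e.owner (.inr i) hdec
  refine ⟨i, m, cs, hi2, hdec, fun b hb => ?_⟩
  have key : ((collectProg' Q R L e b).eval e.crypto e.owner (.inr b)).1 = some (m, cs) := by
    have hz := hroot b (hb.anti (by omega))
    have hcs : ((dealShares L n m).eval e.crypto e.owner (Sum.inr i)).1.2 = cs := by rw [hdeal]
    rw [← hcs]
    refine collectShares_of_valid e.crypto e.owner (.inr b) (.inr i) hm (by rw [hdeal, hz]) ?_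
      hB ?_
    -- `i` hashed the tree when it decoded, and `b` hashes the paths of the shares that it accepts
    · intro y y' hy hy' heq
      exact hclean.1 2 (by omega) (2 + R + 1 + R + 2) le_rfl (.inr i) (.inr b) y y' hi2 hb
        (collectProg_queries (hsub _ hy)) (collectProg'_queries hy') heq
    · intro j hj
      have hj := (Finset.mem_filter.1 hj).2
      rw [fromReceivers_relay (hj.anti (by omega)), hz, ← hroot j (hj.anti (by omega))]
      refine pickShare_valid e.crypto e.owner (.inr j) (.inr b) i ?_
      rw [fromReceivers_deal hi hgoi hx, hroot j (hj.anti (by omega))]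
      have := checkShare_dealShares e.crypto e.owner (Sum.inr j) (Sum.inr i) (n := n) (L := L) m j
      rwa [hdeal] at this
  rw [key]; rfl

open Classical in
theorem agreement_supersend {t : ℕ}
    (hBA : ∀ owner : Fin n → P, AchievesBAIn Q κ κ t R owner)
    (hκ : 1 ≤ κ)
    (hclean : (supersend Q κ R L).Clean e (2 + R + 1 + R + 2))
    (ht : numIn (fun b : Fin n => e.owner (.inr b)) (e.corrupt (2 + R + 1 + R + 2)) ≤ t)
    (hB : n < 2 * (Finset.univ.filter fun b : Fin n =>
      e.Honest (2 + R + 1 + R + 2) (.inr b)).card) :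
    ∃ o, ∀ b, e.Honest (2 + R + 1 + R + 2) (.inr b) →
      (supersend Q κ R L).outputAt e (2 + R + 1 + R + 2) (.inr b) = some o := by
  obtain ⟨-, hagree'⟩ := knownExec_spec hBA hκ hclean ht
  by_cases hgo : ∃ b₀, e.Honest (2 + R + 1 + R + 2) (.inr b₀) ∧
      Q.outputAt (knownExec Q R L e) R b₀ = some [true]
  · obtain ⟨b₀, hb₀, hgo⟩ := hgo
    obtain ⟨-, m, -, -, -, h⟩ := collect_of_go hBA hκ hclean ht hB hb₀ hgo
    refine ⟨some m, fun b hb => ?_⟩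
    rw [outputAt_receiver, h b hb,
      if_pos ((hagree' b b₀ (hb.anti (by omega)) (hb₀.anti (by omega))).trans hgo)]
  · refine ⟨none, fun b hb => ?_⟩
    rw [outputAt_receiver, if_neg fun h => hgo ⟨b, hb, h⟩]

open Classical in
theorem delivery_supersend {t : ℕ}
    (hBA : ∀ owner : Fin n → P, AchievesBAIn Q κ κ t R owner)
    (hκ : 1 ≤ κ)
    (hclean : (supersend Q κ R L).Clean e (2 + R + 1 + R + 2))
    (ht : numIn (fun b : Fin n => e.owner (.inr b)) (e.corrupt (2 + R + 1 + R + 2)) ≤ t)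
    (hB : n < 2 * (Finset.univ.filter fun b : Fin n =>
      e.Honest (2 + R + 1 + R + 2) (.inr b)).card)
    {m : Bits} (hm : m.length ≤ L)
    (hA : nA < 2 * (Finset.univ.filter fun a : Fin nA =>
      e.Honest (2 + R + 1 + R + 2) (.inl a) ∧ e.input (.inl a) = m).card)
    {b : Fin n} (hb : e.Honest (2 + R + 1 + R + 2) (.inr b)) :
    (supersend Q κ R L).outputAt e (2 + R + 1 + R + 2) (.inr b) = some (some m) := by
  obtain ⟨hvalid, -⟩ := rootExec_spec hBA hclean ht
  obtain ⟨hvalid', -⟩ := knownExec_spec hBA hκ hclean ht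
  obtain ⟨z, hroot, hdec⟩ := decoded_of_majority hclean (by omega) hB hm hA
  have hagreed : ∀ i, e.Honest (2 + R) (.inr i) → agreedRoot Q R L e i = z := by
    intro i hi
    rw [agreedRoot, hvalid z (fun j hj => ?_) i hi]
    · rfl
    · obtain ⟨cs, hcs⟩ := hdec j (Execution.Honest.anti (r' := 2 + R) hj (by omega))
      change rootInput Q R L e j = z
      rw [rootInput, hcs, ← hroot j]
      rfl
  have hgo : Q.outputAt (knownExec Q R L e) R b = some [true] := by
    refine hvalid' [true] (fun i hi => ?_) b (hb.anti (by omega))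
    have hi : e.Honest (2 + R + 1 + R) (.inr i) := hi
    obtain ⟨cs, hcs⟩ := hdec i (hi.anti (by omega))
    have hz := hagreed i (hi.anti (by omega))
    simp [knownExec, Execution.sub, knownMessage, hcs, hroot i, hz]
  obtain ⟨i, m', cs, hi, hdec', h⟩ := collect_of_go hBA hκ hclean ht hB hb hgo
  obtain ⟨cs', hcs'⟩ := hdec i hi
  obtain rfl : m' = m := by
    rw [hdec'] at hcs'
    exact congrArg Prod.fst (Option.some.inj hcs')
  rw [outputAt_receiver, if_pos hgo, h b hb]

end Correctness

/-! ### Communication and number of cryptographic operations -/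

section Complexity

variable {nA n κ : ℕ} {P : Type} {Q : Protocol (Fin n) Bits} {R L : ℕ}
  {e : Execution (Fin nA ⊕ Fin n) P κ}

open Classical in
/-- Number of bits that honest parties send in round `r` of the supersending protocol. -/
noncomputable def roundBits (Q : Protocol (Fin n) Bits) (R L : ℕ)
    (e : Execution (Fin nA ⊕ Fin n) P κ) (r : ℕ) : ℕ :=
  ∑ i, ∑ j, if e.Honest r i ∧ e.owner i ≠ e.owner j then
    ((supersend Q κ R L).outgoing i ((supersend Q κ R L).run e r i).1 j).length else 0

theorem roundBits_zero_le : roundBits Q R L e 0 ≤ nA * (n * (κ + certLen κ L n)) := by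
  unfold roundBits
  rw [Fintype.sum_sum_type]
  have hrec : ∀ b : Fin n, ∀ j, ((supersend Q κ R L).outgoing (.inr b)
      ((supersend Q κ R L).run e 0 (.inr b)).1 j).length = 0 := by
    rintro b (a | b') <;> rfl
  simp only [hrec, ite_self, Finset.sum_const_zero, Nat.add_zero]
  refine (Finset.sum_le_card_nsmul _ _ (n * (κ + certLen κ L n)) fun a _ => ?_).trans (by simp)
  rw [Fintype.sum_sum_type]
  have hsend : ∀ a' : Fin nA, ((supersend Q κ R L).outgoing (.inl a)
      ((supersend Q κ R L).run e 0 (.inl a)).1 (.inl a')).length = 0 := by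
    intro a'; rw [run_sender_zero]; rfl
  simp only [hsend, ite_self, Finset.sum_const_zero, Nat.zero_add]
  refine (Finset.sum_le_card_nsmul _ _ (κ + certLen κ L n) fun b _ => ?_).trans (by simp)
  split_ifs
  · rw [run_sender_zero]
    change List.length (_ ++ _) ≤ _
    rw [List.length_append, length_dealShares_root, length_dealShares_cert]
  · exact Nat.zero_le _

open Classical in
/-- After round 0, only messages among the receivers are sent. -/
theorem roundBits_succ (r : ℕ) : roundBits Q R L e (r + 1) =
    ∑ b : Fin n, ∑ j : Fin n, if e.Honest (r + 1) (.inr b) ∧ e.owner (.inr b) ≠ e.owner (.inr j)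
      then ((supersend Q κ R L).outgoing (.inr b)
        ((supersend Q κ R L).run e (r + 1) (.inr b)).1 (.inr j)).length else 0 := by
  unfold roundBits
  rw [Fintype.sum_sum_type]
  have hsend : ∀ a : Fin nA, ∀ j, ((supersend Q κ R L).outgoing (.inl a)
      ((supersend Q κ R L).run e (r + 1) (.inl a)).1 j).length = 0 := by
    intro a j; rw [run_sender_succ]; rfl
  simp only [hsend, ite_self, Finset.sum_const_zero, Nat.zero_add]
  refine Finset.sum_congr rfl fun b _ => ?_
  rw [Fintype.sum_sum_type]
  have hrec : ∀ a : Fin nA, ((supersend Q κ R L).outgoing (.inr b)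
      ((supersend Q κ R L).run e (r + 1) (.inr b)).1 (.inl a)).length = 0 := by
    intro a
    unfold Protocol.outgoing
    split_ifs <;> rfl
  simp only [hrec, ite_self, Finset.sum_const_zero, Nat.zero_add]

theorem roundBits_succ_le {r c : ℕ} (h : ∀ b j : Fin n, ((supersend Q κ R L).outgoing (.inr b)
    ((supersend Q κ R L).run e (r + 1) (.inr b)).1 (.inr j)).length ≤ c) :
    roundBits Q R L e (r + 1) ≤ n * (n * c) := by
  rw [roundBits_succ]
  refine (Finset.sum_le_card_nsmul _ _ (n * c) fun b _ => ?_).trans (by simp)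
  refine (Finset.sum_le_card_nsmul _ _ c fun j _ => ?_).trans (by simp)
  split_ifs
  · exact h b j
  · exact Nat.zero_le _

theorem length_knownMessage {i : Fin n} {x : Bits × (Fin n → Bits)}
    (h : knownMessage Q R L e i = some x) (j : Fin n) : (x.2 j).length = certLen κ L n := by
  obtain ⟨hx, -⟩ := Option.filter_eq_some_iff.1 h
  obtain ⟨⟨m, cs⟩, hdec, rfl⟩ := Option.map_eq_some_iff.1 hx
  obtain ⟨-, hdeal, -⟩ := collectShares_eq_some e.crypto e.owner (.inr i) hdec
  have := length_dealShares_cert (n := n) (L := L) e.crypto e.owner (Sum.inr i) m j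
  rwa [hdeal] at this

/-- The receivers exchange certified shares three times, and run two agreements. -/
theorem bitsSent_supersend_le : (supersend Q κ R L).bitsSent e (2 + R + 1 + R + 2) ≤
    nA * (n * (κ + certLen κ L n)) + 3 * (n * (n * certLen κ L n)) +
      Q.bitsSent (rootExec Q R L e) R + Q.bitsSent (knownExec Q R L e) R := by
  classical
  have h0 := roundBits_zero_le (Q := Q) (R := R) (L := L) (e := e)
  have h1 : roundBits Q R L e 1 ≤ n * (n * certLen κ L n) := by
    refine roundBits_succ_le fun b j => ?_
    rw [run_receiver_one]
    exact length_pickShare_le _ _ _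
  have h2 : ∑ r ∈ Finset.range R, roundBits Q R L e (2 + r) =
      Q.bitsSent (rootExec Q R L e) R := by
    refine Finset.sum_congr rfl fun r hr => ?_
    have hr := Finset.mem_range.1 hr
    rw [show 2 + r = 1 + r + 1 by omega, roundBits_succ, show 1 + r + 1 = 2 + r by omega]
    refine Finset.sum_congr rfl fun b _ => Finset.sum_congr rfl fun j _ => ?_
    rw [run_root Q R L e r hr.le]
    refine if_congr Iff.rfl ?_ rfl
    simp [Protocol.outgoing, supersend, supersendSend, hr]
  have h3 : roundBits Q R L e (2 + R) ≤ n * (n * 0) := by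
    rw [show 2 + R = 1 + R + 1 by omega]
    refine roundBits_succ_le fun b j => ?_
    rw [show 1 + R + 1 = 2 + R by omega, run_root Q R L e R le_rfl]
    simp [Protocol.outgoing, supersend, supersendSend]
  have h4 : ∑ r ∈ Finset.range R, roundBits Q R L e (2 + R + 1 + r) =
      Q.bitsSent (knownExec Q R L e) R := by
    refine Finset.sum_congr rfl fun r hr => ?_
    have hr := Finset.mem_range.1 hr
    rw [show 2 + R + 1 + r = 2 + R + r + 1 by omega, roundBits_succ,
      show 2 + R + r + 1 = 2 + R + 1 + r by omega]
    refine Finset.sum_congr rfl fun b _ => Finset.sum_congr rfl fun j _ => ?_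
    rw [run_known Q R L e r hr.le]
    refine if_congr Iff.rfl ?_ rfl
    simp [Protocol.outgoing, supersend, supersendSend, hr]
  have h5 : roundBits Q R L e (2 + R + 1 + R) ≤ n * (n * certLen κ L n) := by
    rw [show 2 + R + 1 + R = 2 + R + R + 1 by omega]
    refine roundBits_succ_le fun b j => ?_
    rw [show 2 + R + R + 1 = 2 + R + 1 + R by omega, run_known Q R L e R le_rfl]
    simp only [Protocol.outgoing, supersend, supersendSend, lt_irrefl, if_false,
      Option.isSome_none, Bool.false_eq_true]
    split_ifs
    · cases hk : knownMessage Q R L e b with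
      | none => simp
      | some x => exact (length_knownMessage hk j).le
    · simp
  have h6 : roundBits Q R L e (2 + R + 1 + R + 1) ≤ n * (n * certLen κ L n) := by
    refine roundBits_succ_le fun b j => ?_
    rw [run_relay']
    exact length_pickShare_le _ _ _
  have hsum : (supersend Q κ R L).bitsSent e (2 + R + 1 + R + 2) =
      ∑ r ∈ Finset.range (2 + R + 1 + R + 1 + 1), roundBits Q R L e r := rfl
  rw [hsum, Finset.sum_range_succ, Finset.sum_range_succ, Finset.sum_range_add,
    Finset.sum_range_succ, Finset.sum_range_add, h2, h4, Finset.sum_range_succ,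
    Finset.sum_range_one]
  omega

open Classical in
/-- Number of cryptographic operations of honest parties at time `r` of the supersending
protocol. -/
noncomputable def roundQueries (Q : Protocol (Fin n) Bits) (R L : ℕ)
    (e : Execution (Fin nA ⊕ Fin n) P κ) (r : ℕ) : ℕ :=
  ∑ i, if e.Honest r i then ((supersend Q κ R L).queriesAt e r i).length else 0

theorem roundQueries_zero_le : roundQueries Q R L e 0 ≤ nA * (2 * 2 ^ treeDepth n) := by
  unfold roundQueries
  rw [Fintype.sum_sum_type]
  have hrec : ∀ b : Fin n, ((supersend Q κ R L).queriesAt e 0 (.inr b)).length = 0 :=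
    fun _ => rfl
  simp only [hrec, ite_self, Finset.sum_const_zero, Nat.add_zero]
  refine (Finset.sum_le_card_nsmul _ _ (2 * 2 ^ treeDepth n) fun a _ => ?_).trans (by simp)
  split_ifs
  · rw [Protocol.queriesAt, run_sender_zero]
    exact numQueries_dealShares_le _ _ _ _
  · exact Nat.zero_le _

open Classical in
theorem roundQueries_succ (r : ℕ) : roundQueries Q R L e (r + 1) =
    ∑ b : Fin n, if e.Honest (r + 1) (.inr b) then
      ((supersend Q κ R L).queriesAt e (r + 1) (.inr b)).length else 0 := by
  unfold roundQueries
  rw [Fintype.sum_sum_type]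
  have hsend : ∀ a : Fin nA, ((supersend Q κ R L).queriesAt e (r + 1) (.inl a)).length = 0 := by
    intro a; rw [Protocol.queriesAt, run_sender_succ]; rfl
  simp only [hsend, ite_self, Finset.sum_const_zero, Nat.zero_add]

theorem roundQueries_succ_le {r c : ℕ}
    (h : ∀ b : Fin n, ((supersend Q κ R L).queriesAt e (r + 1) (.inr b)).length ≤ c) :
    roundQueries Q R L e (r + 1) ≤ n * c := by
  rw [roundQueries_succ]
  refine (Finset.sum_le_card_nsmul _ _ c fun b _ => ?_).trans (by simp)
  split_ifs
  · exact h b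
  · exact Nat.zero_le _

theorem numQueries_supersend_le : (supersend Q κ R L).numQueries e (2 + R + 1 + R + 2) ≤
    nA * (2 * 2 ^ treeDepth n) + n * (nA * (treeDepth n + 1)) + n * (n * (treeDepth n + 1)) +
      2 * (n * (n * (treeDepth n + 1) + 2 * 2 ^ treeDepth n)) +
      Q.numQueries (rootExec Q R L e) R + Q.numQueries (knownExec Q R L e) R := by
  classical
  have h0 := roundQueries_zero_le (Q := Q) (R := R) (L := L) (e := e)
  have h1 : roundQueries Q R L e 1 ≤ n * (nA * (treeDepth n + 1)) := by
    refine roundQueries_succ_le fun b => ?_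
    rw [Protocol.queriesAt, run_receiver_one]
    exact numQueries_pickShare_le _ _ _ _ _ _
  have h2 : ∑ r ∈ Finset.range (R + 1), roundQueries Q R L e (2 + r) ≤
      n * (n * (treeDepth n + 1) + 2 * 2 ^ treeDepth n) +
        Q.numQueries (rootExec Q R L e) R := by
    have hr : ∀ r ∈ Finset.range (R + 1), roundQueries Q R L e (2 + r) ≤
        (if r = 0 then n * (n * (treeDepth n + 1) + 2 * 2 ^ treeDepth n) else 0) +
        ∑ b, if (rootExec Q R L e).Honest r b then
          (Q.queriesAt (rootExec Q R L e) r b).length else 0 := by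
      intro r hr
      have hr := Finset.mem_range.1 hr
      have hc : (if r = 0 then n * (n * (treeDepth n + 1) + 2 * 2 ^ treeDepth n) else 0) =
          ∑ _b : Fin n, if r = 0 then n * (treeDepth n + 1) + 2 * 2 ^ treeDepth n else 0 := by
        split_ifs <;> simp
      rw [show 2 + r = 1 + r + 1 by omega, roundQueries_succ, show 1 + r + 1 = 2 + r by omega,
        hc, ← Finset.sum_add_distrib]
      refine Finset.sum_le_sum fun b _ => ?_
      by_cases hb : e.Honest (2 + r) (.inr b)
      · rw [if_pos hb, if_pos (show (rootExec Q R L e).Honest r b from hb), Protocol.queriesAt,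
          run_root Q R L e r (by omega), List.length_append, List.length_map]
        refine Nat.add_le_add ?_ le_rfl
        split_ifs
        · exact numQueries_collectShares_le _ _ _ _ _
        · simp
      · rw [if_neg hb]; exact Nat.zero_le _
    refine (Finset.sum_le_sum hr).trans ?_
    rw [Finset.sum_add_distrib, Finset.sum_ite_eq' (Finset.range (R + 1)) 0]
    simp [Protocol.numQueries]
  have h4 : ∑ r ∈ Finset.range (R + 1), roundQueries Q R L e (2 + R + 1 + r) =
      Q.numQueries (knownExec Q R L e) R := by
    refine Finset.sum_congr rfl fun r hr => ?_
    have hr := Finset.mem_range.1 hr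
    rw [show 2 + R + 1 + r = 2 + R + r + 1 by omega, roundQueries_succ,
      show 2 + R + r + 1 = 2 + R + 1 + r by omega]
    refine Finset.sum_congr rfl fun b _ => ?_
    rw [Protocol.queriesAt, run_known Q R L e r (by omega), List.length_map]
    exact if_congr Iff.rfl rfl rfl
  have h5 : roundQueries Q R L e (2 + R + 1 + R + 1) ≤ n * (n * (treeDepth n + 1)) := by
    refine roundQueries_succ_le fun b => ?_
    rw [Protocol.queriesAt, run_relay']
    exact numQueries_pickShare_le _ _ _ _ _ _
  have h6 : roundQueries Q R L e (2 + R + 1 + R + 2) ≤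
      n * (n * (treeDepth n + 1) + 2 * 2 ^ treeDepth n) := by
    refine roundQueries_succ_le (r := 2 + R + 1 + R + 1) fun b => ?_
    rw [Protocol.queriesAt, run_done]
    exact numQueries_collectShares_le _ _ _ _ _
  have hsum : (supersend Q κ R L).numQueries e (2 + R + 1 + R + 2) =
      ∑ r ∈ Finset.range (2 + R + 1 + (R + 1) + 1 + 1), roundQueries Q R L e r := rfl
  rw [hsum, Finset.sum_range_succ, Finset.sum_range_succ, Finset.sum_range_add, h4,
    show 2 + R + 1 = 2 + (R + 1) from rfl, Finset.sum_range_add, Finset.sum_range_succ,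
    Finset.sum_range_one]
  change _ + _ + roundQueries Q R L e (2 + R + 1 + R + 1) +
    roundQueries Q R L e (2 + R + 1 + R + 2) ≤ _
  omega

/-! ### Bounds on the parameters -/

theorem two_pow_treeDepth_le (hn : 1 ≤ n) : 2 ^ treeDepth n ≤ 2 * n := by
  rcases hn.eq_or_lt with rfl | hn
  · simp [treeDepth]
  · have h := Nat.pow_pred_clog_lt_self one_lt_two hn
    have hpos := Nat.clog_pos one_lt_two hn
    rw [treeDepth, ← Nat.succ_pred_eq_of_pos hpos, pow_succ]
    have : 2 ^ (Nat.clog 2 n).pred < n := h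
    omega

theorem treeDepth_add_one_le (hn : 1 ≤ n) : treeDepth n + 1 ≤ 2 * n :=
  Nat.lt_two_pow_self.trans_le (two_pow_treeDepth_le hn)

theorem treeDepth_le_log (hn : 1 ≤ n) : (treeDepth n : ℝ) ≤ 4 * Real.log ((n : ℝ) + 1) := by
  have hn' : (1 : ℝ) ≤ n := by exact_mod_cast hn
  have h2 : (2 : ℝ) ^ treeDepth n ≤ 2 * n := by exact_mod_cast two_pow_treeDepth_le hn
  have h3 : (2 : ℝ) ^ treeDepth n ≤ ((n : ℝ) + 1) ^ 2 := by nlinarith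
  have h4 := Real.log_le_log (by positivity) h3
  rw [Real.log_pow, Real.log_pow] at h4
  have h5 := Real.log_two_gt_d9
  have h6 : (0 : ℝ) ≤ treeDepth n := Nat.cast_nonneg _
  push_cast at h4
  nlinarith

theorem mul_shareLen_le : n * shareLen L n ≤ 2 * (L + 1) + n * (1 + treeDepth n) := by
  have h1 := Nat.div_mul_le_self (L + 1) (n / 2 + 1)
  have h2 : n * ((L + 1) / (n / 2 + 1)) ≤ (2 * (n / 2 + 1)) * ((L + 1) / (n / 2 + 1)) :=
    Nat.mul_le_mul_right _ (by omega)
  unfold shareLen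
  nlinarith

theorem mul_certLen_le (hκ : 1 ≤ κ) (hn : 1 ≤ n) :
    n * (κ + certLen κ L n) ≤ 2 * L + κ * n * (4 + 2 * treeDepth n) := by
  have h1 := mul_shareLen_le (L := L) (n := n)
  have h2 : n * (1 + treeDepth n) ≤ κ * n * (1 + treeDepth n) := by
    rw [Nat.mul_assoc]; exact Nat.le_mul_of_pos_left _ hκ
  have h3 : 1 ≤ κ * n := Nat.mul_pos hκ hn
  unfold certLen
  nlinarith

end Complexity

section Bounds

variable {nA n κ L q b₁ b₂ c : ℕ}

theorem operations_bound (hn : 1 ≤ n) :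
    nA * (2 * 2 ^ treeDepth n) + n * (nA * (treeDepth n + 1)) + n * (n * (treeDepth n + 1)) +
      2 * (n * (n * (treeDepth n + 1) + 2 * 2 ^ treeDepth n)) + q + q ≤
      20 * ((nA + n) ^ 3 + q) := by
  have h1 := two_pow_treeDepth_le hn
  have h2 := treeDepth_add_one_le hn
  set N := nA + n with hN
  have hnN : n ≤ N := by omega
  have hAN : nA ≤ N := by omega
  have hN1 : 1 ≤ N := by omega
  calc _ ≤ N * (2 * (2 * N)) + N * (N * (2 * N)) + N * (N * (2 * N)) +
        2 * (N * (N * (2 * N) + 2 * (2 * N))) + q + q := by gcongr <;> omega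
    _ = 8 * N ^ 3 + 12 * (N ^ 2 * 1) + 2 * q := by ring
    _ ≤ 8 * N ^ 3 + 12 * (N ^ 2 * N) + 2 * q := by gcongr
    _ ≤ 20 * (N ^ 3 + q) := by ring_nf; omega

theorem communication_bound (hκ : 1 ≤ κ) (hn : 1 ≤ n)
    (h₁ : b₁ ≤ c * ((κ + κ) * n ^ 2)) (h₂ : b₂ ≤ c * ((κ + κ) * n ^ 2)) :
    ((nA * (n * (κ + certLen κ L n)) + 3 * (n * (n * certLen κ L n)) + b₁ + b₂ : ℕ) : ℝ) ≤
      ((48 + 8 * c : ℕ) : ℝ) * ((L : ℝ) * (nA + n) +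
        (κ : ℝ) * n * Real.log ((n : ℝ) + 1) * (nA + n)) := by
  set ℓ := Real.log ((n : ℝ) + 1) with hℓ
  have hn' : (1 : ℝ) ≤ n := by exact_mod_cast hn
  have hℓ1 : 1 ≤ 2 * ℓ := by
    have h5 := Real.log_two_gt_d9
    have := Real.log_le_log two_pos (show (2 : ℝ) ≤ n + 1 by linarith)
    linarith
  have hd := treeDepth_le_log hn
  set X := n * (κ + certLen κ L n) with hX
  have hX1 : n * certLen κ L n ≤ X := Nat.mul_le_mul_left _ (Nat.le_add_left _ _)
  have hnat : nA * X + 3 * (n * (n * certLen κ L n)) + b₁ + b₂ ≤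
      3 * ((nA + n) * X) + 4 * (c * (κ * n * n)) := by
    have h3 := Nat.mul_le_mul_left n hX1
    have h4 : c * ((κ + κ) * n ^ 2) = 2 * (c * (κ * n * n)) := by ring
    rw [h4] at h₁ h₂
    rw [Nat.add_mul]
    omega
  have hXr : (X : ℝ) ≤ 2 * L + κ * n * (16 * ℓ) := by
    have h1 : (X : ℝ) ≤ 2 * L + κ * n * (4 + 2 * treeDepth n) := by
      exact_mod_cast mul_certLen_le hκ hn
    -- the logarithm is at least `1 / 2`, which absorbs the summand that does not depend on it
    have h2 : (κ : ℝ) * n * (4 + 2 * treeDepth n) ≤ κ * n * (16 * ℓ) := by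
      refine mul_le_mul_of_nonneg_left ?_ (by positivity)
      linarith
    linarith
  have hA : (0 : ℝ) ≤ nA := Nat.cast_nonneg _
  have h1 : ((nA : ℝ) + n) * X ≤ (nA + n) * (2 * L + κ * n * (16 * ℓ)) :=
    mul_le_mul_of_nonneg_left hXr (by positivity)
  have h2 : (c : ℝ) * (κ * n * n) ≤ c * (κ * n * (nA + n)) * (2 * ℓ) := by
    have h3 : (c : ℝ) * (κ * n * n) ≤ c * (κ * n * (nA + n)) := by gcongr; linarith
    exact h3.trans (le_mul_of_one_le_right (by positivity) hℓ1)
  have h3 : (0 : ℝ) ≤ (42 + 8 * c) * (L * (nA + n)) := by positivity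
  calc _ ≤ ((3 * ((nA + n) * X) + 4 * (c * (κ * n * n)) : ℕ) : ℝ) := by exact_mod_cast hnat
    _ = 3 * (((nA : ℝ) + n) * X) + 4 * (c * (κ * n * n)) := by push_cast; ring
    _ ≤ 3 * ((nA + n) * (2 * L + κ * n * (16 * ℓ))) +
        4 * (c * (κ * n * (nA + n)) * (2 * ℓ)) := by linarith
    _ ≤ _ := by push_cast; linarith

end Bounds

/-! ### Supersending from Byzantine Agreement -/

open Classical in
theorem mainTheorem10
    -- the Byzantine Agreement protocol, for security parameter `κ`, input length `L`, `n` parties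
    (BA : (κ L n : ℕ) → Protocol (Fin n) Bits)
    -- its resilience, its round complexity and its communication complexity
    (t R : ℕ → ℕ) (B : ℕ → ℕ → ℕ → ℕ)
    (hBA : ∀ κ L n, 1 ≤ κ → 1 ≤ L → 1 ≤ n → AchievesBA (BA κ L n) κ L (t n) (R n))
    (hcomplexity : ∀ κ L n, 1 ≤ κ → 1 ≤ L → 1 ≤ n →
      HasComplexity (BA κ L n) κ L (t n) (R n) (B κ L n))
    (hR : ∃ c : ℕ, ∀ n, 1 ≤ n → R n ≤ c * n)
    (hB : ∃ c : ℕ, ∀ κ L n, 1 ≤ κ → 1 ≤ L → 1 ≤ n → B κ L n ≤ c * ((L + κ) * n ^ 2))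
    (hmps : ∀ κ L n, 1 ≤ κ → 1 ≤ L → 1 ≤ n →
      MultiParticipationSafe (BA κ L n) κ L (t n) (R n))
    (hecs : ∀ κ L n, 1 ≤ κ → 1 ≤ L → 1 ≤ n →
      ExtraCorruptionsSafe (BA κ L n) κ L (t n) (R n) (B κ L n)) :
    -- the supersending protocol from group `A = Fin nA` to group `B = Fin nB`
    ∃ (SS : (κ L nA nB : ℕ) → Protocol (Fin nA ⊕ Fin nB) (Option Bits))
      (T : ℕ → ℕ → ℕ) (C : ℕ),
      (∀ nA nB, 1 ≤ nA → 1 ≤ nB → T nA nB ≤ C * nB) ∧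
      ∀ κ L nA nB, 1 ≤ κ → 1 ≤ nA → 1 ≤ nB →
        -- no signatures are used if the Byzantine Agreement protocol uses none
        ((BA κ κ nB).SigFree → (SS κ L nA nB).SigFree) ∧
        -- only polynomially many cryptographic operations, beyond those of Byzantine Agreement
        (∀ q : ℕ,
          (∀ (P : Type) (e : Execution (Fin nB) P κ), e.InputsAtMost κ →
            (BA κ κ nB).numQueries e (R nB) ≤ q) →
          ∀ (P : Type) (e : Execution (Fin nA ⊕ Fin nB) P κ),
            (SS κ L nA nB).numQueries e (T nA nB) ≤ C * ((nA + nB) ^ 3 + q)) ∧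
        ∀ (P : Type) (e : Execution (Fin nA ⊕ Fin nB) P κ),
          (∀ a : Fin nA, e.Honest 0 (.inl a) → (e.input (.inl a)).length ≤ L) →
          (SS κ L nA nB).Clean e (T nA nB) →
          -- all honest parties complete within `T nA nB` rounds
          (SS κ L nA nB).Terminates e (T nA nB) ∧
          -- every honest member of `B` completes with an `L`-bit output or `⊥`
          (∀ b : Fin nB, e.Honest (T nA nB) (.inr b) →
            ∃ o : Option Bits, (SS κ L nA nB).outputAt e (T nA nB) (.inr b) = some o ∧
              ∀ m, o = some m → m.length ≤ L) ∧
          -- communication complexity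
          (((SS κ L nA nB).bitsSent e (T nA nB) : ℕ) : ℝ) ≤
            C * ((L : ℝ) * (nA + nB) +
              (κ : ℝ) * nB * Real.log ((nB : ℝ) + 1) * (nA + nB)) ∧
          -- agreement
          (numIn (fun b : Fin nB => e.owner (.inr b)) (e.corrupt (T nA nB)) ≤ t nB →
            nB < 2 * (Finset.univ.filter fun b : Fin nB => e.Honest (T nA nB) (.inr b)).card →
            (∃ o : Option Bits, ∀ b : Fin nB, e.Honest (T nA nB) (.inr b) →
              (SS κ L nA nB).outputAt e (T nA nB) (.inr b) = some o) ∧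
            -- delivery of the message held by an honest majority of `A`
            ∀ m : Bits,
              nA < 2 * (Finset.univ.filter fun a : Fin nA =>
                e.Honest (T nA nB) (.inl a) ∧ e.input (.inl a) = m).card →
              ∀ b : Fin nB, e.Honest (T nA nB) (.inr b) →
                (SS κ L nA nB).outputAt e (T nA nB) (.inr b) = some (some m)) := by
  obtain ⟨cR, hcR⟩ := hR
  obtain ⟨cB, hcB⟩ := hB
  -- the summands of the constant serve the rounds, and the communication and the operations
  refine ⟨fun κ L nA n => supersend (BA κ κ n) κ (R n) L, fun _ n => 2 + R n + 1 + R n + 2,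
    5 + 2 * cR + (48 + 8 * cB), fun nA n hnA hn => ?_, fun κ L nA n hκ hnA hn =>
    ⟨supersend_sigFree _ κ (R n) L, fun q hq P e => ?_, fun P e hL hclean => ?_⟩⟩
  · have := hcR n hn
    nlinarith
  · refine numQueries_supersend_le.trans ?_
    have h1 := hq P (rootExec (BA κ κ n) (R n) L e) inputsAtMost_rootExec
    have h2 := hq P (knownExec (BA κ κ n) (R n) L e) (inputsAtMost_knownExec hκ)
    refine (Nat.add_le_add (Nat.add_le_add_left h1 _) h2).trans ((operations_bound hn).trans ?_)
    exact Nat.mul_le_mul_right _ (by omega)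
  · have hBA' : ∀ owner : Fin n → P, AchievesBAIn (BA κ κ n) κ κ (t n) (R n) owner :=
      hmps κ κ n hκ hκ hn (hBA κ κ n hκ hκ hn) P
    refine ⟨terminates_supersend, fun b _ => ⟨_, outputAt_receiver b, fun m => length_output_le⟩,
      ?_, fun ht hhon => ⟨agreement_supersend hBA' hκ hclean ht hhon, fun m hm b hb => ?_⟩⟩
    · have h1 := (hecs κ κ n hκ hκ hn (hcomplexity κ κ n hκ hκ hn) P
        (rootExec (BA κ κ n) (R n) L e) inputsAtMost_rootExec (clean_rootExec hclean)).2
      have h2 := (hecs κ κ n hκ hκ hn (hcomplexity κ κ n hκ hκ hn) P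
        (knownExec (BA κ κ n) (R n) L e) (inputsAtMost_knownExec hκ) (clean_knownExec hclean)).2
      refine (Nat.cast_le.2 bitsSent_supersend_le).trans ((communication_bound hκ hn
        (h1.trans (hcB κ κ n hκ hκ hn)) (h2.trans (hcB κ κ n hκ hκ hn))).trans ?_)
      have hlog : 0 ≤ Real.log ((n : ℝ) + 1) := Real.log_nonneg (by simp)
      refine mul_le_mul_of_nonneg_right (Nat.cast_le.2 (by omega)) (by positivity)
    · obtain ⟨a, ha⟩ := Finset.card_pos.1 (Nat.pos_of_mul_pos_left (Nat.zero_le nA |>.trans_lt hm))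
      obtain ⟨haT, rfl⟩ := (Finset.mem_filter.1 ha).2
      exact delivery_supersend hBA' hκ hclean ht hhon (hL a (haT.anti (Nat.zero_le _))) hm hb
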